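/- **Theorem.** Let $\mathbf L$ and $\mathbf U$ be finite algebras in the same purely functional language $F$. Suppose $\mathbf L$ is affine over a module with addition $+$ and zero element $0\in L$ (i.e. $\mathbf L$ is a Mal'tsev algebra and all of its term operations have the form $\sum_i \alpha_i x_i + c$ over this module), and that $f^{\mathbf L}(0,\dots,0)=0$ for every $f\in F$. Let $T=(\hat f)_{f\in F}$ be a family of operations $\hat f\colon U^n\to L$ ($n$ the arity of $f$), and let $\mathbf A=\mathbf L\otimes^{T,0}\mathbf U$ be the wreath product, i.e. the algebra on $L\times U$ with basic operations $$f^{\mathbf A}((l_1,u_1),\dots,(l_n,u_n))=\bigl(f^{\mathbf L}(l_1,\dots,l_n)+\hat f(u_1,\dots,u_n),\,f^{\mathbf U}(u_1,\dots,u_n)\bigr).$$ Assume that $\mathbf A$ is a Mal'tsev algebra, i.e. it has a ternary term operation $m$ with $m(y,x,x)=m(x,x,y)=y$ for all $x,y$, and that $\mathrm{Clo}(\mathbf L\times\mathbf U)\subseteq\mathrm{Clo}(\mathbf A)$, where $\mathrm{Clo}$ denotes the clone of term operations. Let $\mathcal C=\mathrm{Diff}_0(\mathbf A)$ be the difference clonoid: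 the set of all $\hat r\colon U^n\to L$ ($n\in\mathbb N$) for which there are $n$-ary terms $t,s$ with $t^{\mathbf L\times\mathbf U}=s^{\mathbf L\times\mathbf U}$ and a map $\hat t\colon U^n\to L$ such that, for all $\mathbf l\in L^n$, $\mathbf u\in U^n$, the value of $t^{\mathbf A}$ at $((l_1,u_1),\dots,(l_n,u_n))$ is $(t^{\mathbf L}(\mathbf l)+\hat t(\mathbf u),t^{\mathbf U}(\mathbf u))$ and that of $s^{\mathbf A}$ is $(t^{\mathbf L}(\mathbf l)+\hat t(\mathbf u)+\hat r(\mathbf u),t^{\mathbf U}(\mathbf u))$. For $R\subseteq X^k$, the signature $\mathrm{Sig}(R)$ is the set of all $(i,a,b)\in\{1,\dots,k\}\times X^2$ for which there are $\mathbf s,\mathbf t\in R$ that agree on the first $i-1$ coordinates and satisfy $\mathbf s(i)=a$, $\mathbf t(i)=b$. A *compact representation* of $R$ is a subset $S\subseteq R$ with $\mathrm{Sig}(S)=\mathrm{Sig}(R)$ and $|S|\le 2|\mathrm{Sig}(R)|$. Consider the following problems, where $n$ and $k$ are part of the input: * $\mathrm{CompRep}(\mathbf B)$, for a finite algebra $\mathbf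 B$: given $\mathbf a_1,\dots,\mathbf a_n\in B^k$, output a compact representation of the subalgebra $\mathrm{Sg}_{\mathbf B^k}(\mathbf a_1,\dots,\mathbf a_n)$ of $\mathbf B^k$ generated by them; * $\mathrm{CompRep}(\mathcal C)$: given $\mathbf u_1,\dots,\mathbf u_n\in U^k$, output a compact representation of $\mathcal C(\mathbf u_1,\dots,\mathbf u_n)=\{f(\mathbf u_1,\dots,\mathbf u_n)\mid f\in\mathcal C\ n\text{-ary}\}\subseteq L^k$ ($f$ applied coordinatewise); * $\mathrm{SMP}(\mathbf A)$: given $\mathbf b,\mathbf a_1,\dots,\mathbf a_n\in A^k$, decide whether $\mathbf b\in\mathrm{Sg}_{\mathbf A^k}(\mathbf a_1,\dots,\mathbf a_n)$. Then both $\mathrm{CompRep}(\mathbf A)$ and $\mathrm{SMP}(\mathbf A)$ reduce in polynomial time to $\mathrm{CompRep}(\mathbf L\times\mathbf U)$ and $\mathrm{CompRep}(\mathcal C)$: for each of the two problems there is an algorithm that, given arbitrary oracles solving $\mathrm{CompRep}(\mathbf L\times\mathbf U)$ and $\mathrm{CompRep}(\mathcal C)$, solves it in time polynomial in the input length (with a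 polynomial independent of the oracles). -/

import Mathlib

open FirstOrder FirstOrder.Language

universe v w

/-! ### Universal algebra

Algebras are structures of a first-order language without relation symbols.  Since several algebras
live on the same set, the structures are passed explicitly. -/

/-- The operation induced by a term. -/
def termOp {F : FirstOrder.Language.{v, w}} {X : Type} (S : F.Structure X) {n : ℕ}
    (t : F.Term (Fin n)) : (Fin n → X) → X :=
  fun x => t.realize x

/-- The clone of term operations, at arity `n`. -/
def Clo {F : FirstOrder.Language.{v, w}} {X : Type} (S : F.Structure X) (n : ℕ) :
    Set ((Fin n → X) → X) :=
  Set.range (termOp S)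

/-- Some ternary term operation `m` satisfies `m(y,x,x) = y = m(x,x,y)`. -/
def IsMaltsev {F : FirstOrder.Language.{v, w}} {X : Type} (S : F.Structure X) : Prop :=
  ∃ m ∈ Clo S 3, ∀ x y, m ![y, x, x] = y ∧ m ![x, x, y] = y

/-- The algebra is a Mal'tsev algebra all of whose term operations are affine combinations
over the given module. -/
def IsAffine {F : FirstOrder.Language.{v, w}} {X : Type} (R : Type*) [Ring R] [AddCommGroup X] [Module R X]
    (S : F.Structure X) : Prop :=
  IsMaltsev S ∧
    ∀ n, ∀ f ∈ Clo S n, ∃ (α : Fin n → R) (c : X), ∀ x, f x = ∑ i, α i • x i + c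

/-- The direct product of two algebras in the same language. -/
abbrev prodAlg {F : FirstOrder.Language.{v, w}} [F.IsAlgebraic] {L U : Type}
    (SL : F.Structure L) (SU : F.Structure U) : F.Structure (L × U) where
  funMap f x := (SL.funMap f fun i => (x i).1, SU.funMap f fun i => (x i).2)

/-- The power `A^k` of an algebra. -/
abbrev powAlg {F : FirstOrder.Language.{v, w}} [F.IsAlgebraic] {X : Type}
    (S : F.Structure X) (k : ℕ) : F.Structure (Fin k → X) where
  funMap f x := fun j => S.funMap f fun i => x i j

/-- The wreath product with basic operations `(f^L(l) + f̂(u), f^U(u))`. -/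
abbrev wreathAlg {F : FirstOrder.Language.{v, w}} [F.IsAlgebraic] {L U : Type} [Add L]
    (SL : F.Structure L) (SU : F.Structure U)
    (T : ∀ n, F.Functions n → (Fin n → U) → L) : F.Structure (L × U) where
  funMap {n} f x :=
    (SL.funMap f (fun i => (x i).1) + T n f (fun i => (x i).2), SU.funMap f fun i => (x i).2)

/-- The subalgebra of `A^k` generated by a list of tuples. -/
def Sg {F : FirstOrder.Language.{v, w}} [F.IsAlgebraic] {X : Type} (S : F.Structure X) {k : ℕ}
    (as : List (Fin k → X)) : Set (Fin k → X) :=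
  letI := powAlg S k
  (FirstOrder.Language.Substructure.closure F {a | a ∈ as} : Set (Fin k → X))

/-- The difference clonoid of the wreath product, at arity `n`: all `r̂ : U^n → L` for which there
are terms `t, s` inducing the same operation on `L × U`, such that, on the wreath product,
`t(l,u) = (t^L(l) + t̂(u), t^U(u))` and `s(l,u) = (t^L(l) + t̂(u) + r̂(u), t^U(u))`. -/
def Diff0 {F : FirstOrder.Language.{v, w}} [F.IsAlgebraic] {L U : Type} [Add L]
    (SL : F.Structure L) (SU : F.Structure U)
    (T : ∀ n, F.Functions n → (Fin n → U) → L) (n : ℕ) : Set ((Fin n → U) → L) :=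
  {r | ∃ (t s : F.Term (Fin n)) (t' : (Fin n → U) → L),
    termOp (prodAlg SL SU) t = termOp (prodAlg SL SU) s ∧
    ∀ (l : Fin n → L) (u : Fin n → U),
      termOp (wreathAlg SL SU T) t (fun i => (l i, u i)) =
        (termOp SL t l + t' u, termOp SU t u) ∧
      termOp (wreathAlg SL SU T) s (fun i => (l i, u i)) =
        (termOp SL t l + t' u + r u, termOp SU t u)}

/-- The image `C(u_1,…,u_n) = {f(u_1,…,u_n) | f ∈ C}`, with `f` applied coordinatewise. -/
def clonoidImage {U L : Type} (C : ∀ n, Set ((Fin n → U) → L)) {k : ℕ}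
    (us : List (Fin k → U)) : Set (Fin k → L) :=
  {y | ∃ f ∈ C us.length, ∀ j, y j = f fun i => us.get i j}

/-! ### Compact representations -/

/-- The signature of a set of tuples. -/
def Sig {X : Type} {k : ℕ} (R : Set (Fin k → X)) : Set (Fin k × X × X) :=
  {p | ∃ s ∈ R, ∃ t ∈ R, (∀ j < p.1, s j = t j) ∧ s p.1 = p.2.1 ∧ t p.1 = p.2.2}

/-- `S` is a compact representation of `R`. -/
def IsCompactRep {X : Type} {k : ℕ} (S R : Set (Fin k → X)) : Prop :=
  S ⊆ R ∧ Sig S = Sig R ∧ S.ncard ≤ 2 * (Sig R).ncard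

/-! ### Search problems -/

/-- A search problem over finite alphabets: instances are given as words through `enc`,
and `Sol x w` says that the word `w` is a correct answer to the instance `x`. -/
structure SearchProblem where
  Inst : Type
  In : Type
  Out : Type
  finite_In : Finite In
  finite_Out : Finite Out
  enc : Inst → List In
  Sol : Inst → List Out → Prop

/-- A finite list of tuples of a common length `k`. -/
structure TupleList (X : Type) where
  k : ℕ
  tuples : List (Fin k → X)

/-- The alphabet for lists of tuples: the elements of `X`, a symbol preceding each tuple,
and a symbol for writing the length of the tuples in unary. -/
inductive TupleSym (X : Type) where
  | el (x : X)
  | sep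
  | unit

instance {X : Type} [Finite X] : Finite (TupleSym X) :=
  Finite.of_injective
    (fun s : TupleSym X => match s with
      | .el x => some (some x)
      | .sep => some none
      | .unit => none)
    (by rintro (_ | _ | _) (_ | _ | _) h <;> simp_all)

def encTuples {X : Type} {k : ℕ} (as : List (Fin k → X)) : List (TupleSym X) :=
  as.flatMap fun a => TupleSym.sep :: List.ofFn fun j => TupleSym.el (a j)

/-- The word `1^k | a_1(1) … a_1(k) | … | a_n(1) … a_n(k)`. -/
def TupleList.enc {X : Type} (x : TupleList X) : List (TupleSym X) :=
  List.replicate x.k TupleSym.unit ++ encTuples x.tuples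

/-- Given a list of tuples over `X`, output a compact representation of the set `gen` of tuples
over `Y` determined by it (its elements listed without repetition). -/
abbrev compRepProblem {X Y : Type} [Finite X] [Finite Y]
    (gen : ∀ k, List (Fin k → X) → Set (Fin k → Y)) : SearchProblem where
  Inst := TupleList X
  In := TupleSym X
  Out := TupleSym Y
  finite_In := inferInstance
  finite_Out := inferInstance
  enc := TupleList.enc
  Sol x o := ∃ S : List (Fin x.k → Y), S.Nodup ∧
    IsCompactRep {a | a ∈ S} (gen x.k x.tuples) ∧ o = encTuples S

/-- Computing compact representations of generated subpowers of an algebra. -/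
abbrev CompRep {F : FirstOrder.Language.{v, w}} [F.IsAlgebraic] {X : Type} [Finite X]
    (S : F.Structure X) : SearchProblem :=
  compRepProblem fun _ as => Sg S as

/-- Computing compact representations of the images of tuples under a clonoid. -/
abbrev CompRepClonoid {U L : Type} [Finite U] [Finite L] (C : ∀ n, Set ((Fin n → U) → L)) :
    SearchProblem :=
  compRepProblem fun _ us => clonoidImage C us

/-- The subpower membership problem: given `b, a_1, …, a_n`, decide whether `b` lies in the
subalgebra generated by `a_1, …, a_n`. -/
abbrev SMP {F : FirstOrder.Language.{v, w}} [F.IsAlgebraic] {X : Type} [Finite X]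
    (S : F.Structure X) : SearchProblem where
  Inst := Σ k, (Fin k → X) × List (Fin k → X)
  In := TupleSym X
  Out := Bool
  finite_In := inferInstance
  finite_Out := inferInstance
  enc x := TupleList.enc ⟨x.1, x.2.1 :: x.2.2⟩
  Sol x o := ∃ d : Bool, (d = true ↔ x.2.1 ∈ Sg S x.2.2) ∧ o = [d]

/-! ### Oracle machines and polynomial-time reductions

A machine has finitely many tapes, used as stacks (two of them simulate a Turing tape), over finite
alphabets: an input tape, an output tape, a query tape and an answer tape for every oracle, and
work tapes.  It has a finite internal memory, and its control is a structured program. -/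

inductive Tape (ι κ : Type) where
  | inp
  | out
  | qry (i : ι)
  | ans (i : ι)
  | work (j : κ)

/-- The alphabets of the tapes of a machine for `P` with oracles for `Q i` and work alphabet `Γ`. -/
abbrev Tape.Letter (P : SearchProblem) {ι κ : Type} (Q : ι → SearchProblem) (Γ : Type) :
    Tape ι κ → Type
  | .inp => P.In
  | .out => P.Out
  | .qry i => (Q i).In
  | .ans i => (Q i).Out
  | .work _ => Γ

/-- Programs, for tape alphabets `Λ` and internal memory `σ`. -/
inductive Prog {ι κ : Type} (Λ : Tape ι κ → Type) (σ : Type) where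
  | load (f : σ → σ)
  | push (k : Tape ι κ) (f : σ → Λ k)
  | pop (k : Tape ι κ) (f : σ → Option (Λ k) → σ)
  | query (i : ι)
  | seq (c d : Prog Λ σ)
  | ite (b : σ → Bool) (c d : Prog Λ σ)
  | loop (b : σ → Bool) (c : Prog Λ σ)

structure Config {ι κ : Type} (Λ : Tape ι κ → Type) (σ : Type) where
  mem : σ
  tape : ∀ k, List (Λ k)

open scoped Classical in
/-- `Run O c s t s'`: with oracles `O`, the program `c` started in `s` halts in `s'` after exactly
`t` steps.  Every instruction, every test and every oracle call is one step; an oracle call puts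
the oracle's answer to the content of the query tape on the answer tape and clears the
query tape. -/
inductive Run {ι κ : Type} {Λ : Tape ι κ → Type} {σ : Type}
    (O : ∀ i, List (Λ (.qry i)) → List (Λ (.ans i))) :
    Prog Λ σ → Config Λ σ → ℕ → Config Λ σ → Prop where
  | load (f : σ → σ) (s : Config Λ σ) : Run O (.load f) s 1 ⟨f s.mem, s.tape⟩
  | push (k : Tape ι κ) (f : σ → Λ k) (s : Config Λ σ) :
      Run O (.push k f) s 1 ⟨s.mem, Function.update s.tape k (f s.mem :: s.tape k)⟩
  | pop (k : Tape ι κ) (f : σ → Option (Λ k) → σ) (s : Config Λ σ) :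
      Run O (.pop k f) s 1
        ⟨f s.mem (s.tape k).head?, Function.update s.tape k (s.tape k).tail⟩
  | query (i : ι) (s : Config Λ σ) :
      Run O (.query i) s 1
        ⟨s.mem, Function.update (Function.update s.tape (.ans i) (O i (s.tape (.qry i))))
          (.qry i) []⟩
  | seq {c d : Prog Λ σ} {s s' s'' : Config Λ σ} {m n : ℕ} :
      Run O c s m s' → Run O d s' n s'' → Run O (.seq c d) s (m + n) s''
  | ite_true {b : σ → Bool} {c : Prog Λ σ} (d : Prog Λ σ) {s s' : Config Λ σ} {m : ℕ} :
      b s.mem = true → Run O c s m s' → Run O (.ite b c d) s (m + 1) s'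
  | ite_false {b : σ → Bool} (c : Prog Λ σ) {d : Prog Λ σ} {s s' : Config Λ σ} {m : ℕ} :
      b s.mem = false → Run O d s m s' → Run O (.ite b c d) s (m + 1) s'
  | loop_done {b : σ → Bool} (c : Prog Λ σ) {s : Config Λ σ} :
      b s.mem = false → Run O (.loop b c) s 1 s
  | loop_step {b : σ → Bool} {c : Prog Λ σ} {s s' s'' : Config Λ σ} {m n : ℕ} :
      b s.mem = true → Run O c s m s' → Run O (.loop b c) s' n s'' →
      Run O (.loop b c) s (m + n + 1) s''

/-- The initial configuration: the input word on the input tape, all other tapes empty. -/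
def Config.start {P : SearchProblem} {ι κ : Type} {Q : ι → SearchProblem} {Γ σ : Type}
    (m : σ) (x : List P.In) : Config (Tape.Letter P Q Γ (κ := κ)) σ where
  mem := m
  tape
    | .inp => x
    | .out => []
    | .qry _ => []
    | .ans _ => []
    | .work _ => []

/-- `O` answers every instance of `P` correctly (and is arbitrary on other words). -/
def SearchProblem.Solves (P : SearchProblem) (O : List P.In → List P.Out) : Prop :=
  ∀ x, P.Sol x (O (P.enc x))

/-- Polynomial-time (Turing) reducibility of the search problem `P` to the search problems `Q i`:
a single machine with a single polynomial time bound solves `P`, whatever correct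
oracles for the `Q i` it is given. -/
def PolyTimeReduces (P : SearchProblem) {ι : Type} (Q : ι → SearchProblem) : Prop :=
  ∃ (κ Γ σ : Type) (_ : Finite κ) (_ : Finite Γ) (_ : Finite σ)
    (c : Prog (Tape.Letter P Q Γ (κ := κ)) σ) (m : σ) (p : Polynomial ℕ),
    ∀ O : ∀ i, List (Q i).In → List (Q i).Out, (∀ i, (Q i).Solves (O i)) →
      ∀ x : P.Inst, ∃ (t : ℕ) (s : Config (Tape.Letter P Q Γ (κ := κ)) σ),
        Run O c (Config.start m (P.enc x)) t s ∧
        t ≤ p.eval (P.enc x).length ∧ P.Sol x (s.tape .out)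

/-! Since every basic operation of `L` is affine and fixes `0`, every term operation of `L` is
additive. Hence a term `t` acts on the wreath product `A` as `t` on `L × U` plus a correction `t'`
that depends only on the `U`-coordinates (`IsAffine.termOp_wreathAlg`). The clone inclusion gives a
term `s` whose operation on `A` is exactly that of `t` on `L × U`. Comparing at `0` shows that `s`
and `t` also agree on `L × U`, so the correction `t'` is the difference of `t` and `s` on `A` and
belongs to the difference clonoid.

Let `D ⊆ L^k` be the image of the `U`-parts of the generators under the clonoid. The subpower of `A`
generated by `as` consists of the elements of the subpower of `L × U` generated by `as`, translated
by `D` in the `L`-part. A Mal'tsev term acts as `x - y + z` on `L`, which makes `D` closed under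
subtraction, and a compact representation of such a `D` generates it as a group
(`IsCompactRep.subset_closure`). The same term turns the elements `b` and `b + d` into translation
by `d`. So, for any `b` in the `L × U`-subpower, the `A`-subpower is generated over `L × U` by `as`
and the tuples `b + d`, where `d` runs through a compact representation of `D`
(`IsAffine.Sg_wreathAlg`). One call to each oracle therefore yields a compact representation of the
`A`-subpower.

For membership, such a representation is used for sifting. Starting from any element `x` of the
subpower, a pair `p, q` that first differs at coordinate `i`, with `p i = x i` and `q i = b i`,
replaces `x` by `m(x, p, q)`. This keeps the coordinates below `i` and corrects coordinate `i`.
After `k` passes over all pairs, `x` equals `b` exactly when `b` is a member (`mem_iff_siftPass`).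

The rest implements both algorithms on stack machines and bounds their running time. The number of
tuples in a compact representation is at most `2 k |X|^2`, and `k` is at most the input length
because it is written in unary. -/

/-! ### Terms, generated subpowers and products -/

section TermOperations

variable {F : FirstOrder.Language.{v, w}} {X : Type}

theorem termOp_func (S : F.Structure X) {n m : ℕ} (f : F.Functions m) (ts : Fin m → F.Term (Fin n))
    (x : Fin n → X) :
    termOp S (Term.func f ts) x = S.funMap f fun i => termOp S (ts i) x := rfl

theorem termOp_subst (S : F.Structure X) {n m : ℕ} (t : F.Term (Fin m))
    (ts : Fin m → F.Term (Fin n)) (x : Fin n → X) :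
    termOp S (t.subst ts) x = termOp S t fun i => termOp S (ts i) x :=
  letI := S
  Term.realize_subst

variable [F.IsAlgebraic]

theorem realize_powAlg (S : F.Structure X) {k : ℕ} {α : Type*} (t : F.Term α) (x : α → Fin k → X)
    (j : Fin k) :
    (letI := powAlg S k; t.realize x j) = (letI := S; t.realize fun i => x i j) := by
  induction t with
  | var => rfl
  | func f ts ih => exact congrArg (S.funMap f) (funext ih)

theorem mem_Sg_iff (S : F.Structure X) {k : ℕ} (as : List (Fin k → X)) (y : Fin k → X) :
    y ∈ Sg S as ↔
      ∃ t : F.Term (Fin as.length), ∀ j, y j = termOp S t fun i => as.get i j := by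
  let := powAlg S k
  have h : y ∈ Sg S as ↔ y ∈ Substructure.closure F {a | a ∈ as} := Iff.rfl
  rw [h, Substructure.mem_closure_iff_exists_term]
  constructor
  · rintro ⟨t, rfl⟩
    choose g hg using fun a : {a | a ∈ as} => List.get_of_mem a.2
    refine ⟨t.relabel g, fun j => ?_⟩
    rw [realize_powAlg, termOp]
    let := S
    rw [Term.realize_relabel]
    congr 1
    funext i
    exact congrFun (hg i).symm j
  · rintro ⟨t, ht⟩
    refine ⟨t.relabel fun i => ⟨as.get i, List.get_mem as i⟩, ?_⟩
    funext j
    rw [Term.realize_relabel, realize_powAlg, ht]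
    rfl

theorem subset_Sg (S : F.Structure X) {k : ℕ} {as : List (Fin k → X)} {a : Fin k → X}
    (ha : a ∈ as) : a ∈ Sg S as :=
  let := powAlg S k
  Substructure.subset_closure ha

theorem Sg_subset (S : F.Structure X) {k : ℕ} {as : List (Fin k → X)} {W : Set (Fin k → X)}
    (h : ∀ a ∈ as, a ∈ W)
    (hW : ∀ n (f : F.Functions n) (x : Fin n → Fin k → X), (∀ i, x i ∈ W) →
      (fun j => S.funMap f fun i => x i j) ∈ W) : Sg S as ⊆ W := by
  let := powAlg S k
  let N : F.Substructure (Fin k → X) := ⟨W, fun f x hx => hW _ f x hx⟩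
  exact (Substructure.closure_le (S := N)).2 h

theorem termOp_mem_Sg (S : F.Structure X) {k n : ℕ} {as : List (Fin k → X)} (t : F.Term (Fin n))
    {x : Fin n → Fin k → X} (hx : ∀ i, x i ∈ Sg S as) :
    (fun j => termOp S t fun i => x i j) ∈ Sg S as := by
  choose ts hts using fun i => (mem_Sg_iff S as (x i)).1 (hx i)
  refine (mem_Sg_iff S as _).2 ⟨t.subst ts, fun j => ?_⟩
  simp only [termOp_subst, hts]

theorem Sg_mono (S : F.Structure X) {k : ℕ} {as bs : List (Fin k → X)} (h : as ⊆ bs) :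
    Sg S as ⊆ Sg S bs :=
  let := powAlg S k
  Substructure.closure_mono fun _ ha => h ha

theorem termOp_prodAlg {L U : Type} (SL : F.Structure L) (SU : F.Structure U) {n : ℕ}
    (t : F.Term (Fin n)) (x : Fin n → L × U) :
    termOp (prodAlg SL SU) t x = (termOp SL t fun i => (x i).1, termOp SU t fun i => (x i).2) := by
  induction t with
  | var => rfl
  | func f ts ih =>
    simp only [termOp_func, ih]
    rfl

end TermOperations

/-! ### Additivity of terms and the form of terms on the wreath product -/

section Affine

variable {F : FirstOrder.Language.{v, w}} {R : Type*} [Ring R] {L : Type} [AddCommGroup L]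
  [Module R L] {SL : F.Structure L}

/-- At the zero vector the affine form reduces to its constant, which `hL0` forces to vanish. -/
theorem IsAffine.funMap_add (hL : IsAffine R SL)
    (hL0 : ∀ n (f : F.Functions n), SL.funMap f (fun _ => 0) = 0) {n : ℕ} (f : F.Functions n)
    (x y : Fin n → L) : SL.funMap f (x + y) = SL.funMap f x + SL.funMap f y := by
  obtain ⟨α, c, h⟩ := hL.2 n (fun x => SL.funMap f x) ⟨Term.func f Term.var, rfl⟩
  have hc := h fun _ => 0
  simp only [hL0, smul_zero, Finset.sum_const_zero, zero_add] at hc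
  simp [h, ← hc, smul_add, Finset.sum_add_distrib]

theorem termOp_zero (hL0 : ∀ n (f : F.Functions n), SL.funMap f (fun _ => 0) = 0) {n : ℕ}
    (t : F.Term (Fin n)) : termOp SL t (fun _ => 0) = 0 := by
  induction t with
  | var => rfl
  | func f ts ih => simp only [termOp_func, ih, hL0]

theorem IsAffine.termOp_add (hL : IsAffine R SL)
    (hL0 : ∀ n (f : F.Functions n), SL.funMap f (fun _ => 0) = 0) {n : ℕ} (t : F.Term (Fin n))
    (x y : Fin n → L) : termOp SL t (x + y) = termOp SL t x + termOp SL t y := by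
  induction t with
  | var => rfl
  | func f ts ih =>
    simp only [termOp_func, ih]
    exact hL.funMap_add hL0 f _ _

/-- By additivity it is enough to evaluate `m` at `(l 0 - l 1, 0, 0)`, `(l 1, l 1, 0)` and `(0, 0, l
2)`, where the Mal'tsev identities give the value. -/
theorem IsAffine.maltsev_eq (hL : IsAffine R SL)
    (hL0 : ∀ n (f : F.Functions n), SL.funMap f (fun _ => 0) = 0) (m : F.Term (Fin 3))
    (hm : ∀ x y, termOp SL m ![y, x, x] = y ∧ termOp SL m ![x, x, y] = y) (l : Fin 3 → L) :
    termOp SL m l = l 0 - l 1 + l 2 := by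
  have h0 : l = ![l 0 - l 1, 0, 0] + (![l 1, l 1, 0] + ![0, 0, l 2]) := by
    funext i
    fin_cases i <;> simp
  conv_lhs => rw [h0]
  rw [hL.termOp_add hL0, hL.termOp_add hL0, (hm _ _).1, (hm _ _).2, (hm _ _).2, zero_add]

variable [F.IsAlgebraic] {U : Type} {SU : F.Structure U}
  {T : ∀ n, F.Functions n → (Fin n → U) → L}

/-- The correction of a compound term is `f^L` applied to the corrections of its subterms, plus `T
f` at their `U`-values. Additivity of `f^L` is what separates it from the `L`-part. -/
theorem IsAffine.termOp_wreathAlg (hL : IsAffine R SL)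
    (hL0 : ∀ n (f : F.Functions n), SL.funMap f (fun _ => 0) = 0) {n : ℕ} (t : F.Term (Fin n)) :
    ∃ t' : (Fin n → U) → L, ∀ x : Fin n → L × U, termOp (wreathAlg SL SU T) t x =
      (termOp SL t (fun i => (x i).1) + t' fun i => (x i).2, termOp SU t fun i => (x i).2) := by
  induction t with
  | var => exact ⟨0, fun x => by simp [termOp]⟩
  | func f ts ih =>
    choose ts' h using ih
    refine ⟨fun u => SL.funMap f (fun i => ts' i u) + T _ f fun i => termOp SU (ts i) u,
      fun x => ?_⟩
    have := hL.funMap_add hL0 f (fun i => termOp SL (ts i) fun i => (x i).1)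
      (fun i => ts' i fun i => (x i).2)
    simp only [termOp_func, h, ← add_assoc, ← this]
    rfl

/-- Every term operation of the product is induced on the wreath product by a term that induces it
on the product as well. -/
theorem IsAffine.exists_term_prod (hL : IsAffine R SL)
    (hL0 : ∀ n (f : F.Functions n), SL.funMap f (fun _ => 0) = 0)
    (hClo : ∀ n, Clo (prodAlg SL SU) n ⊆ Clo (wreathAlg SL SU T) n) [Nonempty U] {n : ℕ}
    (t : F.Term (Fin n)) : ∃ s : F.Term (Fin n),
      termOp (wreathAlg SL SU T) s = termOp (prodAlg SL SU) t ∧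
      termOp SL s = termOp SL t ∧ termOp SU s = termOp SU t := by
  obtain ⟨s, hs⟩ := hClo n ⟨t, rfl⟩
  obtain ⟨s', h⟩ := hL.termOp_wreathAlg hL0 (SU := SU) (T := T) s
  have key (l : Fin n → L) (u : Fin n → U) :
      termOp SL s l + s' u = termOp SL t l ∧ termOp SU s u = termOp SU t u := by
    have := h fun i => (l i, u i)
    rw [hs, termOp_prodAlg, Prod.mk.injEq] at this
    exact ⟨this.1.symm, this.2.symm⟩
  refine ⟨s, hs, funext fun l => ?_, funext fun u => (key 0 u).2⟩
  -- At `l = 0` both `L`-values vanish, so the correction `s'` is zero at this `u`; one point of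
  -- `U^n` is enough to compare the operations on `L`.
  let u : Fin n → U := fun _ => Classical.arbitrary U
  have h0 := (key (fun _ => 0) u).1
  rw [termOp_zero hL0, termOp_zero hL0, zero_add] at h0
  simpa [h0] using (key l u).1

/-- A Mal'tsev term inducing the same operation on the product and on the wreath product. -/
theorem IsAffine.exists_maltsev (hL : IsAffine R SL)
    (hL0 : ∀ n (f : F.Functions n), SL.funMap f (fun _ => 0) = 0)
    (hA : IsMaltsev (wreathAlg SL SU T))
    (hClo : ∀ n, Clo (prodAlg SL SU) n ⊆ Clo (wreathAlg SL SU T) n) :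
    ∃ m : F.Term (Fin 3),
      (termOp (wreathAlg SL SU T) m = termOp (prodAlg SL SU) m) ∧
      (∀ l, termOp SL m l = l 0 - l 1 + l 2) ∧
      ∀ x y, termOp SU m ![y, x, x] = y ∧ termOp SU m ![x, x, y] = y := by
  rcases isEmpty_or_nonempty U with hU | hU
  -- With `U` empty the wreath product says nothing about `L`, so the Mal'tsev term of `L` itself is
  -- used.
  · obtain ⟨_, ⟨m, rfl⟩, hm⟩ := hL.1
    exact ⟨m, funext fun x => (hU.false (x 0).2).elim, hL.maltsev_eq hL0 m hm, fun x => hU.elim x⟩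
  · obtain ⟨_, ⟨m, rfl⟩, hm⟩ := hA
    obtain ⟨m', h⟩ := hL.termOp_wreathAlg hL0 (SU := SU) (T := T) m
    have e1 (a b : L × U) : (fun i : Fin 3 => ((![a, b, b] : Fin 3 → L × U) i).1) = ![a.1, b.1, b.1] ∧
        (fun i : Fin 3 => ((![a, b, b] : Fin 3 → L × U) i).2) = ![a.2, b.2, b.2] := by
      constructor <;> funext i <;> fin_cases i <;> rfl
    have e2 (a b : L × U) : (fun i : Fin 3 => ((![b, b, a] : Fin 3 → L × U) i).1) = ![b.1, b.1, a.1] ∧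
        (fun i : Fin 3 => ((![b, b, a] : Fin 3 → L × U) i).2) = ![b.2, b.2, a.2] := by
      constructor <;> funext i <;> fin_cases i <;> rfl
    have z3 : (![0, 0, 0] : Fin 3 → L) = fun _ => 0 := by
      funext i; fin_cases i <;> rfl
    have k1 (a b : L × U) : termOp SL m ![a.1, b.1, b.1] + m' ![a.2, b.2, b.2] = a.1 ∧
        termOp SU m ![a.2, b.2, b.2] = a.2 := by
      have := (hm b a).1
      rw [h, (e1 a b).1, (e1 a b).2] at this
      exact ⟨congrArg Prod.fst this, congrArg Prod.snd this⟩
    have k2 (a b : L × U) : termOp SL m ![b.1, b.1, a.1] + m' ![b.2, b.2, a.2] = a.1 ∧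
        termOp SU m ![b.2, b.2, a.2] = a.2 := by
      have := (hm b a).2
      rw [h, (e2 a b).1, (e2 a b).2] at this
      exact ⟨congrArg Prod.fst this, congrArg Prod.snd this⟩
    -- With all `L`-coordinates zero, the Mal'tsev identities on the wreath product make the
    -- correction vanish on such triples, so `m` is a Mal'tsev term of `L` and of `U` separately.
    have z1 (a b : U) : m' ![a, b, b] = 0 := by
      simpa [z3, termOp_zero hL0] using (k1 (0, a) (0, b)).1
    have z2 (a b : U) : m' ![b, b, a] = 0 := by
      simpa [z3, termOp_zero hL0] using (k2 (0, a) (0, b)).1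
    obtain ⟨s, hs, hs1, hs2⟩ := hL.exists_term_prod hL0 hClo m
    let u := Classical.arbitrary U
    refine ⟨s, ?_, ?_, ?_⟩
    · rw [hs]
      funext x
      rw [termOp_prodAlg, termOp_prodAlg, hs1, hs2]
    · rw [hs1]
      refine hL.maltsev_eq hL0 m fun x y => ⟨?_, ?_⟩
      · simpa [z1] using (k1 (y, u) (x, u)).1
      · simpa [z2] using (k2 (y, u) (x, u)).1
    · rw [hs2]
      exact fun x y => ⟨(k1 (0, y) (0, x)).2, (k2 (0, y) (0, x)).2⟩

end Affine

/-- This is elimination coordinate by coordinate: an element `s` of the generated group that agrees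
with `r` below `i` is improved at `i` by a pair from `S` witnessing `(i, s i, r i)`. The
approximation must stay in `D` for this triple to lie in the signature, hence the closure
hypotheses. -/
theorem IsCompactRep.subset_closure {L : Type} [AddCommGroup L] {k : ℕ} {S D : Set (Fin k → L)}
    (h : IsCompactRep S D) (h0 : 0 ∈ D) (hsub : ∀ x ∈ D, ∀ y ∈ D, x - y ∈ D) :
    D ⊆ AddSubgroup.closure S := by
  intro r hr
  have hadd : ∀ x ∈ D, ∀ y ∈ D, x + y ∈ D := fun x hx y hy => by
    simpa using hsub x hx _ (hsub 0 h0 y hy)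
  have key : ∀ i ≤ k, ∃ s ∈ D, s ∈ AddSubgroup.closure S ∧ ∀ j : Fin k, j.1 < i → s j = r j := by
    intro i
    induction i with
    | zero => exact fun _ => ⟨0, h0, zero_mem _, fun j hj => absurd hj (Nat.not_lt_zero _)⟩
    | succ i ih =>
      intro hi
      obtain ⟨s, hs, hsc, hsr⟩ := ih (by omega)
      have hsig : ((⟨i, hi⟩ : Fin k), s ⟨i, hi⟩, r ⟨i, hi⟩) ∈ Sig S := by
        rw [h.2.1]
        exact ⟨s, hs, r, hr, fun j hj => hsr j hj, rfl, rfl⟩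
      obtain ⟨p, hp, q, hq, hpq, hps, hqr⟩ := hsig
      -- `p` and `q` cancel below `i`; at `i` the term `- p` removes `s i` and `q` supplies `r i`.
      refine ⟨s - p + q, hadd _ (hsub _ hs _ (h.1 hp)) _ (h.1 hq), add_mem (sub_mem hsc
        (AddSubgroup.subset_closure hp)) (AddSubgroup.subset_closure hq), fun j hj => ?_⟩
      rcases Nat.lt_succ_iff_lt_or_eq.1 hj with hj | hj
      · simp [hpq j hj, hsr j hj]
      · obtain rfl : j = ⟨i, hi⟩ := Fin.ext hj
        have hps : p ⟨i, hi⟩ = s ⟨i, hi⟩ := hps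
        have hqr : q ⟨i, hi⟩ = r ⟨i, hi⟩ := hqr
        simp [hps, hqr]
  obtain ⟨s, -, hsc, hsr⟩ := key k le_rfl
  rwa [show s = r from funext fun j => hsr j j.2] at hsc

/-! ### Subpowers of the wreath product as translates by the difference clonoid -/

section Wreath

variable {F : FirstOrder.Language.{v, w}} [F.IsAlgebraic] {R : Type*} [Ring R] {L U : Type}
  [AddCommGroup L] [Module R L] {SL : F.Structure L} {SU : F.Structure U}
  {T : ∀ n, F.Functions n → (Fin n → U) → L}

omit [AddCommGroup L] in
theorem mem_clonoidImage_map {C : ∀ n, Set ((Fin n → U) → L)} {k : ℕ}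
    {as : List (Fin k → L × U)} {y : Fin k → L} :
    y ∈ clonoidImage C (as.map fun a j => (a j).2) ↔
      ∃ f ∈ C as.length, ∀ j, y j = f fun i => (as.get i j).2 := by
  have h (n : ℕ) (us : List (Fin k → U)) (hn : us.length = n) : y ∈ clonoidImage C us ↔
      ∃ f ∈ C n, ∀ j, y j = f fun i => us.get (i.cast hn.symm) j := by
    subst hn; rfl
  rw [h as.length _ (by simp)]
  simp

/-- The elements of the image of the difference clonoid are the differences of the values of terms
inducing the same operation on the product. -/
theorem IsAffine.mem_image_Diff0 (hL : IsAffine R SL)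
    (hL0 : ∀ n (f : F.Functions n), SL.funMap f (fun _ => 0) = 0) {k : ℕ}
    {as : List (Fin k → L × U)} {y : Fin k → L} :
    y ∈ clonoidImage (Diff0 SL SU T) (as.map fun a j => (a j).2) ↔
      ∃ t s : F.Term (Fin as.length), termOp (prodAlg SL SU) t = termOp (prodAlg SL SU) s ∧
        ∀ j, termOp (wreathAlg SL SU T) s (fun i => as.get i j) =
          ((termOp (wreathAlg SL SU T) t fun i => as.get i j).1 + y j,
            (termOp (wreathAlg SL SU T) t fun i => as.get i j).2) := by
  rw [mem_clonoidImage_map]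
  constructor
  · rintro ⟨r, ⟨t, s, t', hts, h⟩, hr⟩
    refine ⟨t, s, hts, fun j => ?_⟩
    have := h (fun i => (as.get i j).1) (fun i => (as.get i j).2)
    rw [this.2, this.1, hr]
  · rintro ⟨t, s, hts, h⟩
    obtain ⟨t', ht'⟩ := hL.termOp_wreathAlg hL0 (SU := SU) (T := T) t
    obtain ⟨s', hs'⟩ := hL.termOp_wreathAlg hL0 (SU := SU) (T := T) s
    have e (l : Fin as.length → L) (u : Fin as.length → U) :
        termOp SL s l = termOp SL t l ∧ termOp SU s u = termOp SU t u := by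
      have := congrFun hts fun i => (l i, u i)
      rw [termOp_prodAlg, termOp_prodAlg, Prod.mk.injEq] at this
      exact ⟨this.1.symm, this.2.symm⟩
    -- The two terms have equal `L`- and `U`-parts, so they differ on the wreath product only by
    -- their corrections.
    refine ⟨fun u => s' u - t' u, ⟨t, s, t', hts, fun l u => ⟨ht' _, ?_⟩⟩, fun j => ?_⟩
    · simp [hs', e l u]
    · have := congrArg Prod.fst (h j)
      rw [hs', ht', (e _ fun i => (as.get i j).2).1, add_assoc] at this
      exact eq_sub_of_add_eq' (add_left_cancel this).symm

variable (hL : IsAffine R SL) (hL0 : ∀ n (f : F.Functions n), SL.funMap f (fun _ => 0) = 0)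
  (hA : IsMaltsev (wreathAlg SL SU T))
  (hClo : ∀ n, Clo (prodAlg SL SU) n ⊆ Clo (wreathAlg SL SU T) n)

include hL hL0 in
-- The term `t` guarantees that the clonoid is nonempty at this arity, which can fail only without
-- generators and without closed terms.
theorem IsAffine.zero_mem_image_Diff0 {k : ℕ} {as : List (Fin k → L × U)}
    (t : F.Term (Fin as.length)) :
    0 ∈ clonoidImage (Diff0 SL SU T) (as.map fun a j => (a j).2) :=
  (hL.mem_image_Diff0 hL0).2 ⟨t, t, rfl, fun j => by simp⟩

include hL hL0 hA hClo

/-- If `x` is the difference from `t` to `s` and `y` the one from `t'` to `s'`, then `m(s, s', t')`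
has `L`-part `(t + x) - (t' + y) + t' = t + (x - y)`. On the product it is `t`, because there `s =
t` and `s' = t'`. -/
theorem IsAffine.sub_mem_image_Diff0 {k : ℕ} {as : List (Fin k → L × U)} {x y : Fin k → L}
    (hx : x ∈ clonoidImage (Diff0 SL SU T) (as.map fun a j => (a j).2))
    (hy : y ∈ clonoidImage (Diff0 SL SU T) (as.map fun a j => (a j).2)) :
    x - y ∈ clonoidImage (Diff0 SL SU T) (as.map fun a j => (a j).2) := by
  obtain ⟨m, hm, hmL, hmU⟩ := hL.exists_maltsev hL0 hA hClo
  obtain ⟨t, s, hts, h⟩ := (hL.mem_image_Diff0 hL0).1 hx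
  obtain ⟨t', s', hts', h'⟩ := (hL.mem_image_Diff0 hL0).1 hy
  refine (hL.mem_image_Diff0 hL0).2 ⟨t, m.subst ![s, s', t'], ?_, fun j => ?_⟩
  · funext z
    rw [termOp_subst, termOp_prodAlg SL SU m, hmL]
    have e : (fun i => (termOp (prodAlg SL SU) (![s, s', t'] i) z).2) =
        ![(termOp (prodAlg SL SU) s z).2, (termOp (prodAlg SL SU) s' z).2,
          (termOp (prodAlg SL SU) s' z).2] := by
      funext i; fin_cases i <;> simp [hts']
    rw [e, (hmU _ _).1]
    simp [hts, hts']
  · rw [termOp_subst, hm, termOp_prodAlg, hmL]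
    have e : (fun i => (termOp (wreathAlg SL SU T) (![s, s', t'] i) fun i => as.get i j).2) =
        ![(termOp (wreathAlg SL SU T) t fun i => as.get i j).2,
          (termOp (wreathAlg SL SU T) t' fun i => as.get i j).2,
          (termOp (wreathAlg SL SU T) t' fun i => as.get i j).2] := by
      funext i; fin_cases i
      · simpa using congrArg Prod.snd (h j)
      · simpa using congrArg Prod.snd (h' j)
      · rfl
    rw [e, (hmU _ _).1]
    have h1 := congrArg Prod.fst (h j)
    have h2 := congrArg Prod.fst (h' j)
    simp only [List.get_eq_getElem] at h1 h2
    simp [h1, h2]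
    abel

/-- If `d` is the difference from `t` to `s` and `p` is a term for `x`, then `m(p, t, s)` evaluates
to `p - t + (t + d) = p + d` in the `L`-part and to `p` in the `U`-part. -/
theorem IsAffine.add_mem_Sg_wreathAlg {k : ℕ} {as : List (Fin k → L × U)} {x : Fin k → L × U}
    {d : Fin k → L} (hx : x ∈ Sg (wreathAlg SL SU T) as)
    (hd : d ∈ clonoidImage (Diff0 SL SU T) (as.map fun a j => (a j).2)) :
    (fun j => ((x j).1 + d j, (x j).2)) ∈ Sg (wreathAlg SL SU T) as := by
  obtain ⟨m, hm, hmL, hmU⟩ := hL.exists_maltsev hL0 hA hClo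
  obtain ⟨t, s, hts, h⟩ := (hL.mem_image_Diff0 hL0).1 hd
  obtain ⟨p, hp⟩ := (mem_Sg_iff _ _ _).1 hx
  refine (mem_Sg_iff _ _ _).2 ⟨m.subst ![p, t, s], fun j => ?_⟩
  rw [termOp_subst, hm, termOp_prodAlg, hmL]
  have e : (fun i => (termOp (wreathAlg SL SU T) (![p, t, s] i) fun i => as.get i j).2) =
      ![(termOp (wreathAlg SL SU T) p fun i => as.get i j).2,
        (termOp (wreathAlg SL SU T) t fun i => as.get i j).2,
        (termOp (wreathAlg SL SU T) t fun i => as.get i j).2] := by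
    funext i; fin_cases i
    · rfl
    · rfl
    · simpa using congrArg Prod.snd (h j)
  rw [e, (hmU _ _).1, hp]
  have h1 := congrArg Prod.fst (h j)
  simp only [List.get_eq_getElem] at h1
  simp [h1]
  abel

omit hL hL0 hA in
-- The clone inclusion makes every subpower of the wreath product closed under the operations of the
-- product.
theorem Sg_prodAlg_subset {k : ℕ} {as bs : List (Fin k → L × U)}
    (h : ∀ b ∈ bs, b ∈ Sg (wreathAlg SL SU T) as) :
    Sg (prodAlg SL SU) bs ⊆ Sg (wreathAlg SL SU T) as := by
  refine Sg_subset _ h fun n f x hx => ?_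
  obtain ⟨s, hs⟩ := hClo n ⟨Term.func f Term.var, rfl⟩
  have := termOp_mem_Sg (wreathAlg SL SU T) s hx
  rwa [hs] at this

/-- Translation by a generator `d` is `m(x, b, b + d)` and translation by `-d` is `m(x, b + d, b)`.
The element `b` is needed only if there is a generator, since the subpower may be empty otherwise.
-/
theorem IsAffine.add_mem_Sg_prodAlg {k : ℕ} {as : List (Fin k → L × U)} {x b : Fin k → L × U}
    {ds : Set (Fin k → L)} {d : Fin k → L} (hb : ds.Nonempty → b ∈ Sg (prodAlg SL SU) as)
    (hds : ∀ d ∈ ds, (fun j => ((b j).1 + d j, (b j).2)) ∈ Sg (prodAlg SL SU) as)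
    (hx : x ∈ Sg (prodAlg SL SU) as) (hd : d ∈ AddSubgroup.closure ds) :
    (fun j => ((x j).1 + d j, (x j).2)) ∈ Sg (prodAlg SL SU) as := by
  obtain ⟨m, hm, hmL, hmU⟩ := hL.exists_maltsev hL0 hA hClo
  have key : ∀ x y z, x ∈ Sg (prodAlg SL SU) as → y ∈ Sg (prodAlg SL SU) as →
      z ∈ Sg (prodAlg SL SU) as → (∀ j, (y j).2 = (z j).2) →
      (fun j => ((x j).1 - (y j).1 + (z j).1, (x j).2)) ∈ Sg (prodAlg SL SU) as := by
    intro x y z hx hy hz hyz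
    have := termOp_mem_Sg (prodAlg SL SU) m (x := ![x, y, z])
      (by intro i; fin_cases i <;> assumption)
    convert this using 2 with j
    rw [termOp_prodAlg, hmL]
    have e : (fun i => (![x, y, z] i j).2) = ![(x j).2, (y j).2, (y j).2] := by
      funext i; fin_cases i
      · rfl
      · rfl
      · exact (hyz j).symm
    rw [e, (hmU _ _).1]
    simp
  -- Both signs are carried along, for all `x` at once, so that the induction over the generated
  -- group passes through negation and addition.
  suffices h : ∀ x ∈ Sg (prodAlg SL SU) as,
      (fun j => ((x j).1 + d j, (x j).2)) ∈ Sg (prodAlg SL SU) as ∧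
      (fun j => ((x j).1 - d j, (x j).2)) ∈ Sg (prodAlg SL SU) as from (h x hx).1
  clear hx x
  induction hd using AddSubgroup.closure_induction with
  | mem d hd =>
    refine fun x hx => ⟨?_, ?_⟩
    · convert key x _ _ hx (hb ⟨d, hd⟩) (hds d hd) fun _ => rfl using 3
      simp only
      abel
    · convert key x _ _ hx (hds d hd) (hb ⟨d, hd⟩) fun _ => rfl using 3
      simp only
      abel
  | zero => exact fun x hx => ⟨by simpa using hx, by simpa using hx⟩
  | add d e _ _ hd he =>
    refine fun x hx => ⟨?_, ?_⟩
    · simpa [add_assoc] using (he _ (hd x hx).1).1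
    · simpa [sub_sub] using (he _ (hd x hx).2).2
  | neg d _ hd =>
    refine fun x hx => ⟨?_, ?_⟩
    · simpa [← sub_eq_add_neg] using (hd x hx).2
    · simpa using (hd x hx).1

/-- The subpower of the wreath product generated by `as` is generated over the product by `as` and
the translates of one of its elements by a generating set of the image of the difference clonoid. -/
theorem IsAffine.Sg_wreathAlg {k : ℕ} {as : List (Fin k → L × U)} {ds : List (Fin k → L)}
    {b : Fin k → L × U} (hb : ds ≠ [] → b ∈ Sg (prodAlg SL SU) as)
    (hds : IsCompactRep {d | d ∈ ds}
      (clonoidImage (Diff0 SL SU T) (as.map fun a j => (a j).2))) :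
    Sg (wreathAlg SL SU T) as =
      Sg (prodAlg SL SU) (as ++ ds.map fun d j => ((b j).1 + d j, (b j).2)) := by
  have hmono : Sg (prodAlg SL SU) as ⊆ Sg (wreathAlg SL SU T) as :=
    Sg_prodAlg_subset hClo fun a ha => subset_Sg _ ha
  apply subset_antisymm
  · intro x hx
    obtain ⟨t, ht⟩ := (mem_Sg_iff _ _ _).1 hx
    -- A coordinate of `x` supplies a point of `U`; for `k = 0` there may be none, but then the
    -- existence of any term is enough.
    rcases isEmpty_or_nonempty (Fin k) with hk | ⟨⟨j0⟩⟩
    · exact (mem_Sg_iff _ _ _).2 ⟨t.relabel (Fin.castLE (by simp)), fun j => hk.elim j⟩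
    have : Nonempty U := ⟨(x j0).2⟩
    obtain ⟨s, hs, hsL, hsU⟩ := hL.exists_term_prod hL0 hClo t
    obtain ⟨t', h'⟩ := hL.termOp_wreathAlg hL0 (SU := SU) (T := T) t
    have hp : termOp (prodAlg SL SU) s = termOp (prodAlg SL SU) t := by
      funext z
      rw [termOp_prodAlg, termOp_prodAlg, hsL, hsU]
    -- On the wreath product `s` acts as `t` does on the product, so the correction of `t` is the
    -- difference from `s` to `t`.
    have hd : (fun j => t' fun i => (as.get i j).2) ∈
        clonoidImage (Diff0 SL SU T) (as.map fun a j => (a j).2) :=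
      (hL.mem_image_Diff0 hL0).2 ⟨s, t, hp, fun j => by
        rw [hs, h', termOp_prodAlg]⟩
    have hd' := hds.subset_closure (hL.zero_mem_image_Diff0 hL0 t)
      (fun x hx y hy => hL.sub_mem_image_Diff0 hL0 hA hClo hx hy) hd
    have hsub : Sg (prodAlg SL SU) as ⊆
        Sg (prodAlg SL SU) (as ++ ds.map fun d j => ((b j).1 + d j, (b j).2)) :=
      Sg_mono _ (by simp)
    have hx0 : (fun j => termOp (prodAlg SL SU) t fun i => as.get i j) ∈ Sg (prodAlg SL SU) as :=
      (mem_Sg_iff _ _ _).2 ⟨t, fun _ => rfl⟩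
    convert hL.add_mem_Sg_prodAlg hL0 hA hClo (fun h => hsub (hb ?_)) (fun d hd => ?_)
      (hsub hx0) hd' using 2 with j
    · rw [ht, h', termOp_prodAlg]
    · obtain ⟨d, hd⟩ := h
      exact List.ne_nil_of_mem hd
    · exact subset_Sg _ (List.mem_append_right _ (List.mem_map_of_mem hd))
  · refine Sg_prodAlg_subset hClo fun a ha => ?_
    rcases List.mem_append.1 ha with ha | ha
    · exact subset_Sg _ ha
    · obtain ⟨d, hd, rfl⟩ := List.mem_map.1 ha
      exact hL.add_mem_Sg_wreathAlg hL0 hA hClo (hmono (hb (List.ne_nil_of_mem hd))) (hds.1 hd)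

end Wreath

/-! ### Time-bounded execution, loops that consume a tape, and moving tapes -/

section Machine

variable {ι κ : Type} {Λ : Tape ι κ → Type} {σ : Type}

/-- Straight-line programs with tests. -/
def Prog.LoopFree : Prog Λ σ → Prop
  | .load _ => True
  | .push _ _ => True
  | .pop _ _ => True
  | .query _ => True
  | .seq c d => c.LoopFree ∧ d.LoopFree
  | .ite _ c d => c.LoopFree ∧ d.LoopFree
  | .loop _ _ => False

/-- A bound for the running time of a loop-free program. -/
def Prog.cost : Prog Λ σ → ℕ
  | .load _ => 1
  | .push _ _ => 1
  | .pop _ _ => 1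
  | .query _ => 1
  | .seq c d => c.cost + d.cost
  | .ite _ c d => max c.cost d.cost + 1
  | .loop _ _ => 0

variable (O : ∀ i, List (Λ (.qry i)) → List (Λ (.ans i)))

open scoped Classical in
/-- The configuration reached by a loop-free program. -/
noncomputable def Prog.eval : Prog Λ σ → Config Λ σ → Config Λ σ
  | .load f, s => ⟨f s.mem, s.tape⟩
  | .push k f, s => ⟨s.mem, Function.update s.tape k (f s.mem :: s.tape k)⟩
  | .pop k f, s => ⟨f s.mem (s.tape k).head?, Function.update s.tape k (s.tape k).tail⟩
  | .query i, s => ⟨s.mem,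
      Function.update (Function.update s.tape (.ans i) (O i (s.tape (.qry i)))) (.qry i) []⟩
  | .seq c d, s => d.eval (c.eval s)
  | .ite b c d, s => bif b s.mem then c.eval s else d.eval s
  | .loop _ _, s => s

/-- `Reach O c s n s'`: the program `c` started in `s` halts in `s'` within `n` steps. -/
def Reach (c : Prog Λ σ) (s : Config Λ σ) (n : ℕ) (s' : Config Λ σ) : Prop :=
  ∃ t ≤ n, Run O c s t s'

variable {O} {c d : Prog Λ σ} {s s' s'' : Config Λ σ} {m n : ℕ}

theorem Reach.mono (h : Reach O c s m s') (hn : m ≤ n) : Reach O c s n s' :=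
  let ⟨t, ht, hr⟩ := h
  ⟨t, ht.trans hn, hr⟩

theorem Reach.cast (h : Reach O c s m s') (hn : m ≤ n) (hs : s' = s'') : Reach O c s n s'' :=
  hs ▸ h.mono hn

theorem Reach.seq (h : Reach O c s m s') (h' : Reach O d s' n s'') :
    Reach O (.seq c d) s (m + n) s'' :=
  let ⟨_, ht, hr⟩ := h
  let ⟨_, ht', hr'⟩ := h'
  ⟨_, add_le_add ht ht', hr.seq hr'⟩

theorem Reach.ite_true {b : σ → Bool} (hb : b s.mem = true) (h : Reach O c s m s') :
    Reach O (.ite b c d) s (m + 1) s' :=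
  let ⟨_, ht, hr⟩ := h
  ⟨_, Nat.succ_le_succ ht, .ite_true _ hb hr⟩

theorem Reach.ite_false {b : σ → Bool} (hb : b s.mem = false) (h : Reach O d s m s') :
    Reach O (.ite b c d) s (m + 1) s' :=
  let ⟨_, ht, hr⟩ := h
  ⟨_, Nat.succ_le_succ ht, .ite_false _ hb hr⟩

theorem Reach.eval (hc : c.LoopFree) (s : Config Λ σ) : Reach O c s c.cost (c.eval O s) := by
  induction c generalizing s with
  | load f => exact ⟨1, le_rfl, .load f s⟩
  | push k f => exact ⟨1, le_rfl, .push k f s⟩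
  | pop k f => exact ⟨1, le_rfl, .pop k f s⟩
  | query i => exact ⟨1, le_rfl, .query i s⟩
  | seq c d ihc ihd => exact (ihc hc.1 s).seq (ihd hc.2 _)
  | ite b c d ihc ihd =>
    cases hb : b s.mem with
    | true =>
      refine ((ihc hc.1 s).ite_true hb).cast (Nat.succ_le_succ (le_max_left _ _)) ?_
      simp [Prog.eval, hb]
    | false =>
      refine ((ihd hc.2 s).ite_false hb).cast (Nat.succ_le_succ (le_max_right _ _)) ?_
      simp [Prog.eval, hb]
  | loop b c _ => exact hc.elim

open scoped Classical in
theorem Reach.push (k : Tape ι κ) (f : σ → Λ k) (m : σ) (T : ∀ k, List (Λ k)) :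
    Reach O (.push k f) ⟨m, T⟩ 1 ⟨m, Function.update T k (f m :: T k)⟩ :=
  ⟨1, le_rfl, .push k f ⟨m, T⟩⟩

theorem Reach.load (f : σ → σ) (m : σ) (T : ∀ k, List (Λ k)) :
    Reach O (.load f) ⟨m, T⟩ 1 ⟨f m, T⟩ :=
  ⟨1, le_rfl, .load f ⟨m, T⟩⟩

open scoped Classical in
theorem Reach.query (i : ι) (m : σ) (T : ∀ k, List (Λ k)) :
    Reach O (.query i) ⟨m, T⟩ 1
      ⟨m, Function.update (Function.update T (.ans i) (O i (T (.qry i)))) (.qry i) []⟩ :=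
  ⟨1, le_rfl, .query i ⟨m, T⟩⟩

/-- The internal memory: two registers for letters, a phase and a flag. -/
@[ext]
structure Mem (Γ : Type) where
  r : Option Γ
  s : Option Γ
  ph : Fin 3
  ok : Bool

instance {Γ : Type} [Finite Γ] : Finite (Mem Γ) :=
  Finite.of_injective (fun m : Mem Γ => (m.r, m.s, m.ph, m.ok)) fun a b h => by
    simp only [Prod.mk.injEq] at h
    exact Mem.ext h.1 h.2.1 h.2.2.1 h.2.2.2

variable {Γ : Type} {body : Prog Λ (Mem Γ)} {k l : Tape ι κ} {conv : Λ k → Γ}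
  {T : ∀ k, List (Λ k)} {s₁ s₂ s₃ : Option Γ} {ph : Fin 3} {ok : Bool}

/-- Pop the letters of the tape `k` into the first register one after the other, and run `body`
for each of them. -/
def Prog.whilePop (k : Tape ι κ) (conv : Λ k → Γ) (body : Prog Λ (Mem Γ)) : Prog Λ (Mem Γ) :=
  .seq (.pop k fun m a => ⟨a.map conv, m.s, m.ph, m.ok⟩)
    (.loop (fun m => m.r.isSome) (.seq body (.pop k fun m a => ⟨a.map conv, m.s, m.ph, m.ok⟩)))

open scoped Classical

theorem Reach.whilePop_nil (hT : T k = []) :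
    Reach O (.whilePop k conv body) ⟨⟨s₁, s₂, ph, ok⟩, T⟩ 2 ⟨⟨none, s₂, ph, ok⟩, T⟩ := by
  have h : Reach O (.whilePop k conv body) ⟨⟨s₁, s₂, ph, ok⟩, T⟩ 2 _ :=
    ⟨2, le_rfl, .seq (.pop _ _ _) (.loop_done _ (by simp [hT]))⟩
  refine h.cast le_rfl ?_
  simp [hT]

/-- The pop that ends a round of the loop plays the role of the opening pop of the remaining run.
Thus a run on the tail can be extended by one letter, and loops are analysed by induction on the
content of the tape. -/
theorem Reach.whilePop_cons {a : Λ k} {w : List (Λ k)} {s' : Config Λ (Mem Γ)}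
    {u : Config Λ (Mem Γ)} {T' : ∀ k, List (Λ k)} (hT : T k = a :: w)
    (hT' : Function.update T k w = T')
    (hb : Reach O body ⟨⟨some (conv a), s₂, ph, ok⟩, T'⟩ m s')
    (h : Reach O (.whilePop k conv body) s' n u) :
    Reach O (.whilePop k conv body) ⟨⟨s₁, s₂, ph, ok⟩, T⟩ (m + n + 2) u := by
  subst hT'
  obtain ⟨t, ht, hr⟩ := hb
  obtain ⟨t', ht', hr'⟩ := h
  cases hr' with
  | @seq _ _ _ s₃ _ a b hp hl =>
    have ha : a = 1 := by cases hp; rfl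
    subst ha
    have hpop := Run.pop (O := O) k (fun (m : Mem Γ) a => ⟨a.map conv, m.s, m.ph, m.ok⟩)
      ⟨⟨s₁, s₂, ph, ok⟩, T⟩
    simp only [hT, List.head?_cons, Option.map_some, List.tail_cons] at hpop
    exact ⟨1 + (t + 1 + b + 1), by omega, hpop.seq (.loop_step rfl (hr.seq hp) hl)⟩

variable [Inhabited Γ]

/-- Move the content of the tape `k` to the tape `l`, letter by letter. -/
def Prog.move (k l : Tape ι κ) (conv : Λ k → Γ) (g : Γ → Λ l) : Prog Λ (Mem Γ) :=
  .whilePop k conv (.push l fun m => g (m.r.getD default))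

/-- Moving a stack reverses it. Each letter costs three steps: test, push and pop. -/
theorem Reach.move (hkl : k ≠ l) (g : Γ → Λ l) :
    Reach O (.move k l conv g) ⟨⟨s₁, s₂, ph, ok⟩, T⟩ (3 * (T k).length + 2)
      ⟨⟨none, s₂, ph, ok⟩, Function.update (Function.update T k [])
        l (((T k).map (g ∘ conv)).reverse ++ T l)⟩ := by
  generalize hw : T k = w
  induction w generalizing T s₁ with
  | nil =>
    refine (Reach.whilePop_nil hw).cast (by simp) ?_
    simp only [List.map_nil, List.reverse_nil, List.nil_append]
    rw [← hw, Function.update_eq_self, Function.update_eq_self]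
  | cons a w ih =>
    refine (Reach.whilePop_cons hw rfl (Reach.eval (c := .push l _) trivial _) (ih ?_)).cast ?_ ?_
    · simp [hkl]
    · simp [Prog.cost]
      omega
    · simp [hkl.symm, Function.update_comm hkl]

end Machine

/-! ### Tape contents as records -/

section Tapes

/-- Names for the work tapes. -/
inductive WT where
  | c1
  | c2
  | ba
  | st
  | bt
  | kt
  | ft
  | ds
  | ps
  | ps2
  | qs
  | qs2
  | z
  | z2

instance : Finite WT :=
  Finite.of_surjective (![.c1, .c2, .ba, .st, .bt, .kt, .ft, .ds, .ps, .ps2, .qs, .qs2, .z, .z2] : Fin 14 → WT)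
    (by rintro (_ | _ | _ | _ | _ | _ | _ | _ | _ | _ | _ | _ | _ | _)
        exacts [⟨0, rfl⟩,
          ⟨1, rfl⟩,
          ⟨2, rfl⟩,
          ⟨3, rfl⟩,
          ⟨4, rfl⟩,
          ⟨5, rfl⟩,
          ⟨6, rfl⟩,
          ⟨7, rfl⟩,
          ⟨8, rfl⟩,
          ⟨9, rfl⟩,
          ⟨10, rfl⟩,
          ⟨11, rfl⟩,
          ⟨12, rfl⟩,
          ⟨13, rfl⟩])

variable {P : SearchProblem} {Q : Fin 2 → SearchProblem} {Γ : Type}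

/-- The contents of all tapes. -/
structure Tp (P : SearchProblem) (Q : Fin 2 → SearchProblem) (Γ : Type) where
  inp : List P.In
  out : List P.Out
  q0 : List (Q 0).In
  q1 : List (Q 1).In
  a0 : List (Q 0).Out
  a1 : List (Q 1).Out
  c1 : List Γ
  c2 : List Γ
  ba : List Γ
  st : List Γ
  bt : List Γ
  kt : List Γ
  ft : List Γ
  ds : List Γ
  ps : List Γ
  ps2 : List Γ
  qs : List Γ
  qs2 : List Γ
  z : List Γ
  z2 : List Γ

/-- The contents of the tapes as a function of the tape. -/
def Tp.fn (t : Tp P Q Γ) : ∀ k : Tape (Fin 2) WT, List (Tape.Letter P Q Γ k)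
  | .inp => t.inp
  | .out => t.out
  | .qry 0 => t.q0
  | .qry 1 => t.q1
  | .ans 0 => t.a0
  | .ans 1 => t.a1
  | .work .c1 => t.c1
  | .work .c2 => t.c2
  | .work .ba => t.ba
  | .work .st => t.st
  | .work .bt => t.bt
  | .work .kt => t.kt
  | .work .ft => t.ft
  | .work .ds => t.ds
  | .work .ps => t.ps
  | .work .ps2 => t.ps2
  | .work .qs => t.qs
  | .work .qs2 => t.qs2
  | .work .z => t.z
  | .work .z2 => t.z2

variable (t : Tp P Q Γ)

section Fn

@[simp] theorem Tp.fn_inp : t.fn (.inp) = t.inp := rfl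
@[simp] theorem Tp.fn_out : t.fn (.out) = t.out := rfl
@[simp] theorem Tp.fn_q0 : t.fn (.qry 0) = t.q0 := rfl
@[simp] theorem Tp.fn_q1 : t.fn (.qry 1) = t.q1 := rfl
@[simp] theorem Tp.fn_a0 : t.fn (.ans 0) = t.a0 := rfl
@[simp] theorem Tp.fn_a1 : t.fn (.ans 1) = t.a1 := rfl
@[simp] theorem Tp.fn_c1 : t.fn (.work .c1) = t.c1 := rfl
@[simp] theorem Tp.fn_c2 : t.fn (.work .c2) = t.c2 := rfl
@[simp] theorem Tp.fn_ba : t.fn (.work .ba) = t.ba := rfl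
@[simp] theorem Tp.fn_st : t.fn (.work .st) = t.st := rfl
@[simp] theorem Tp.fn_bt : t.fn (.work .bt) = t.bt := rfl
@[simp] theorem Tp.fn_kt : t.fn (.work .kt) = t.kt := rfl
@[simp] theorem Tp.fn_ft : t.fn (.work .ft) = t.ft := rfl
@[simp] theorem Tp.fn_ds : t.fn (.work .ds) = t.ds := rfl
@[simp] theorem Tp.fn_ps : t.fn (.work .ps) = t.ps := rfl
@[simp] theorem Tp.fn_ps2 : t.fn (.work .ps2) = t.ps2 := rfl
@[simp] theorem Tp.fn_qs : t.fn (.work .qs) = t.qs := rfl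
@[simp] theorem Tp.fn_qs2 : t.fn (.work .qs2) = t.qs2 := rfl
@[simp] theorem Tp.fn_z : t.fn (.work .z) = t.z := rfl
@[simp] theorem Tp.fn_z2 : t.fn (.work .z2) = t.z2 := rfl

end Fn

open scoped Classical

section Update

/-- This reduces the simp lemmas below, which turn updates of tape functions into record updates, to
a check tape by tape. -/
theorem Tp.update_fn {t t' : Tp P Q Γ} {k : Tape (Fin 2) WT} {v : List (Tape.Letter P Q Γ k)}
    (h : t'.fn k = v) (h' : ∀ l, l ≠ k → t'.fn l = t.fn l) : Function.update t.fn k v = t'.fn := by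
  funext l
  by_cases hl : l = k
  · subst hl
    simp [h]
  · simp [hl, h' l hl]

@[simp] theorem Tp.update_inp (v : List P.In) :
    Function.update t.fn (.inp) v = { t with inp := v }.fn :=
  update_fn rfl (by
    rintro (_ | _ | i | i | (_ | _)) h <;> first | rfl | (fin_cases i <;> rfl) | exact (h rfl).elim)
@[simp] theorem Tp.update_out (v : List P.Out) :
    Function.update t.fn (.out) v = { t with out := v }.fn :=
  update_fn rfl (by
    rintro (_ | _ | i | i | (_ | _)) h <;> first | rfl | (fin_cases i <;> rfl) | exact (h rfl).elim)
@[simp] theorem Tp.update_q0 (v : List (Q 0).In) :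
    Function.update t.fn (.qry 0) v = { t with q0 := v }.fn :=
  update_fn rfl (by
    rintro (_ | _ | i | i | (_ | _)) h <;> first | rfl | (fin_cases i <;> first | rfl | exact (h rfl).elim))
@[simp] theorem Tp.update_q1 (v : List (Q 1).In) :
    Function.update t.fn (.qry 1) v = { t with q1 := v }.fn :=
  update_fn rfl (by
    rintro (_ | _ | i | i | (_ | _)) h <;> first | rfl | (fin_cases i <;> first | rfl | exact (h rfl).elim))
@[simp] theorem Tp.update_a0 (v : List (Q 0).Out) :
    Function.update t.fn (.ans 0) v = { t with a0 := v }.fn :=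
  update_fn rfl (by
    rintro (_ | _ | i | i | (_ | _)) h <;> first | rfl | (fin_cases i <;> first | rfl | exact (h rfl).elim))
@[simp] theorem Tp.update_a1 (v : List (Q 1).Out) :
    Function.update t.fn (.ans 1) v = { t with a1 := v }.fn :=
  update_fn rfl (by
    rintro (_ | _ | i | i | (_ | _)) h <;> first | rfl | (fin_cases i <;> first | rfl | exact (h rfl).elim))
@[simp] theorem Tp.update_c1 (v : List Γ) :
    Function.update t.fn (.work .c1) v = { t with c1 := v }.fn :=
  update_fn rfl (by
    rintro (_ | _ | i | i | (_ | _)) h <;> first | rfl | (fin_cases i <;> rfl) | exact (h rfl).elim)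
@[simp] theorem Tp.update_c2 (v : List Γ) :
    Function.update t.fn (.work .c2) v = { t with c2 := v }.fn :=
  update_fn rfl (by
    rintro (_ | _ | i | i | (_ | _)) h <;> first | rfl | (fin_cases i <;> rfl) | exact (h rfl).elim)
@[simp] theorem Tp.update_ba (v : List Γ) :
    Function.update t.fn (.work .ba) v = { t with ba := v }.fn :=
  update_fn rfl (by
    rintro (_ | _ | i | i | (_ | _)) h <;> first | rfl | (fin_cases i <;> rfl) | exact (h rfl).elim)
@[simp] theorem Tp.update_st (v : List Γ) :
    Function.update t.fn (.work .st) v = { t with st := v }.fn :=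
  update_fn rfl (by
    rintro (_ | _ | i | i | (_ | _)) h <;> first | rfl | (fin_cases i <;> rfl) | exact (h rfl).elim)
@[simp] theorem Tp.update_bt (v : List Γ) :
    Function.update t.fn (.work .bt) v = { t with bt := v }.fn :=
  update_fn rfl (by
    rintro (_ | _ | i | i | (_ | _)) h <;> first | rfl | (fin_cases i <;> rfl) | exact (h rfl).elim)
@[simp] theorem Tp.update_kt (v : List Γ) :
    Function.update t.fn (.work .kt) v = { t with kt := v }.fn :=
  update_fn rfl (by
    rintro (_ | _ | i | i | (_ | _)) h <;> first | rfl | (fin_cases i <;> rfl) | exact (h rfl).elim)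
@[simp] theorem Tp.update_ft (v : List Γ) :
    Function.update t.fn (.work .ft) v = { t with ft := v }.fn :=
  update_fn rfl (by
    rintro (_ | _ | i | i | (_ | _)) h <;> first | rfl | (fin_cases i <;> rfl) | exact (h rfl).elim)
@[simp] theorem Tp.update_ds (v : List Γ) :
    Function.update t.fn (.work .ds) v = { t with ds := v }.fn :=
  update_fn rfl (by
    rintro (_ | _ | i | i | (_ | _)) h <;> first | rfl | (fin_cases i <;> rfl) | exact (h rfl).elim)
@[simp] theorem Tp.update_ps (v : List Γ) :
    Function.update t.fn (.work .ps) v = { t with ps := v }.fn :=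
  update_fn rfl (by
    rintro (_ | _ | i | i | (_ | _)) h <;> first | rfl | (fin_cases i <;> rfl) | exact (h rfl).elim)
@[simp] theorem Tp.update_ps2 (v : List Γ) :
    Function.update t.fn (.work .ps2) v = { t with ps2 := v }.fn :=
  update_fn rfl (by
    rintro (_ | _ | i | i | (_ | _)) h <;> first | rfl | (fin_cases i <;> rfl) | exact (h rfl).elim)
@[simp] theorem Tp.update_qs (v : List Γ) :
    Function.update t.fn (.work .qs) v = { t with qs := v }.fn :=
  update_fn rfl (by
    rintro (_ | _ | i | i | (_ | _)) h <;> first | rfl | (fin_cases i <;> rfl) | exact (h rfl).elim)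
@[simp] theorem Tp.update_qs2 (v : List Γ) :
    Function.update t.fn (.work .qs2) v = { t with qs2 := v }.fn :=
  update_fn rfl (by
    rintro (_ | _ | i | i | (_ | _)) h <;> first | rfl | (fin_cases i <;> rfl) | exact (h rfl).elim)
@[simp] theorem Tp.update_z (v : List Γ) :
    Function.update t.fn (.work .z) v = { t with z := v }.fn :=
  update_fn rfl (by
    rintro (_ | _ | i | i | (_ | _)) h <;> first | rfl | (fin_cases i <;> rfl) | exact (h rfl).elim)
@[simp] theorem Tp.update_z2 (v : List Γ) :
    Function.update t.fn (.work .z2) v = { t with z2 := v }.fn :=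
  update_fn rfl (by
    rintro (_ | _ | i | i | (_ | _)) h <;> first | rfl | (fin_cases i <;> rfl) | exact (h rfl).elim)

end Update

end Tapes

/-! ### Letters of the tuple encoding -/

section Letters

variable {X Y : Type}

instance : Inhabited (TupleSym X) := ⟨.unit⟩

def TupleSym.map (f : X → Y) : TupleSym X → TupleSym Y
  | .el x => .el (f x)
  | .sep => .sep
  | .unit => .unit

def TupleSym.isEl : TupleSym X → Bool
  | .el _ => true
  | _ => false

def TupleSym.isSep : TupleSym X → Bool
  | .sep => true
  | _ => false

def TupleSym.isUnit : TupleSym X → Bool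
  | .unit => true
  | _ => false

/-- The letters of a tape with default entries `c` for the units and no separators. -/
def TupleSym.entry (c : X) : TupleSym X → Option (TupleSym X)
  | .el x => some (.el x)
  | .sep => none
  | .unit => some (.el c)

@[simp] theorem TupleSym.isEl_el (x : X) : (TupleSym.el x).isEl = true := rfl
@[simp] theorem TupleSym.isEl_sep : (TupleSym.sep : TupleSym X).isEl = false := rfl
@[simp] theorem TupleSym.isEl_unit : (TupleSym.unit : TupleSym X).isEl = false := rfl
@[simp] theorem TupleSym.isSep_el (x : X) : (TupleSym.el x).isSep = false := rfl
@[simp] theorem TupleSym.isSep_sep : (TupleSym.sep : TupleSym X).isSep = true := rfl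
@[simp] theorem TupleSym.isSep_unit : (TupleSym.unit : TupleSym X).isSep = false := rfl
@[simp] theorem TupleSym.isUnit_el (x : X) : (TupleSym.el x).isUnit = false := rfl
@[simp] theorem TupleSym.isUnit_sep : (TupleSym.sep : TupleSym X).isUnit = false := rfl
@[simp] theorem TupleSym.isUnit_unit : (TupleSym.unit : TupleSym X).isUnit = true := rfl

end Letters

/-! ### Reading the input -/

section Reading

variable {P : SearchProblem} {Q : Fin 2 → SearchProblem} {Y : Type}
  {O : ∀ i : Fin 2, List (Q i).In → List (Q i).Out}
  {t : Tp P Q (TupleSym Y)} {r s : Option (TupleSym Y)} {ph : Fin 3} {ok : Bool}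

/-- Programs over the tapes of `Tp`. -/
abbrev TProg (P : SearchProblem) (Q : Fin 2 → SearchProblem) (Γ : Type) :=
  Prog (Tape.Letter P Q Γ (κ := WT)) (Mem Γ)

open scoped Classical

/-- The letter in the first register. -/
def Mem.reg (m : Mem (TupleSym Y)) : TupleSym Y := m.r.getD default

@[simp] theorem Mem.reg_mk (a : TupleSym Y) : (⟨some a, s, ph, ok⟩ : Mem (TupleSym Y)).reg = a := rfl

/-- Push the first register on a work tape. -/
abbrev pushReg (j : WT) : TProg P Q (TupleSym Y) := .push (.work j) fun m => m.reg

/-- Distribute an input letter: entries of the first tuple go to the tape `bt` in phase `1`, all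
others are copied to `c1` and `c2`; the entries, units and separators are recorded on `ba`, `kt`
and `ft`. -/
def readBody (c : Y) : TProg P Q (TupleSym Y) :=
  .ite (fun m => m.reg.isEl)
    (.ite (fun m => decide (m.ph = 1)) (pushReg .bt)
      (.seq (pushReg .c1) (.seq (pushReg .c2) (pushReg .ba))))
    (.ite (fun m => m.reg.isSep)
      (.ite (fun m => decide (m.ph = 0)) (.load fun m => ⟨m.r, m.s, 1, m.ok⟩)
        (.seq (.load fun m => ⟨m.r, m.s, 2, m.ok⟩)
          (.seq (pushReg .c1) (.seq (pushReg .c2) (pushReg .ft)))))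
      (.seq (pushReg .c1) (.seq (pushReg .c2)
        (.seq (.push (.work .ba) fun _ => .el c) (pushReg .kt)))))

theorem loopFree_readBody (c : Y) : (readBody c : TProg P Q (TupleSym Y)).LoopFree := by
  simp [readBody, Prog.LoopFree]

theorem cost_readBody (c : Y) : (readBody c : TProg P Q (TupleSym Y)).cost = 7 := rfl

/-- The tapes after distributing the word `w`. -/
def Tp.read (t : Tp P Q (TupleSym Y)) (c : Y) (w : List (TupleSym Y)) : Tp P Q (TupleSym Y) :=
  { t with
    c1 := w.reverse ++ t.c1
    c2 := w.reverse ++ t.c2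
    ba := w.reverse.filterMap (TupleSym.entry c) ++ t.ba
    kt := w.reverse.filter TupleSym.isUnit ++ t.kt
    ft := w.reverse.filter TupleSym.isSep ++ t.ft }

variable {conv : P.In → TupleSym Y} {c : Y}

theorem reach_readBody_two (a : TupleSym Y) :
    Reach O (readBody c : TProg P Q (TupleSym Y)) ⟨⟨some a, s, 2, ok⟩, t.fn⟩ 7
      ⟨⟨some a, s, 2, ok⟩, (t.read c [a]).fn⟩ := by
  refine (Reach.eval (loopFree_readBody c) _).cast (cost_readBody c).le ?_
  cases a <;> simp [readBody, Prog.eval, TupleSym.entry, Tp.read] <;> rfl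

theorem reach_readBody_unit :
    Reach O (readBody c : TProg P Q (TupleSym Y)) ⟨⟨some .unit, s, ph, ok⟩, t.fn⟩ 7
      ⟨⟨some .unit, s, ph, ok⟩, (t.read c [.unit]).fn⟩ := by
  refine (Reach.eval (loopFree_readBody c) _).cast (cost_readBody c).le ?_
  simp [readBody, Prog.eval, TupleSym.entry, Tp.read]
  rfl

theorem Tp.read_read (v w : List (TupleSym Y)) : (t.read c v).read c w = t.read c (v ++ w) := by
  simp [Tp.read]

/-- In phase `2` every letter is copied. The program for compact representations starts in this
phase, because its input has no distinguished tuple. -/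
theorem reach_read_two (w : List P.In) (hw : t.inp = w) :
    Reach O (.whilePop .inp conv (readBody c)) ⟨⟨r, s, 2, ok⟩, t.fn⟩ (9 * w.length + 2)
      ⟨⟨none, s, 2, ok⟩, (({ t with inp := [] } : Tp P Q _).read c (w.map conv)).fn⟩ := by
  induction w generalizing t r with
  | nil =>
    refine (Reach.whilePop_nil hw).cast le_rfl ?_
    rw [show ({ t with inp := [] } : Tp P Q _) = t by rw [← hw] ]
    simp [Tp.read]
  | cons a w ih =>
    have hb := reach_readBody_two (O := O) (s := s) (ok := ok) (c := c)
      (t := { t with inp := w }) (conv a)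
    refine (Reach.whilePop_cons hw (Tp.update_inp _ _) hb (ih rfl)).cast (by simp; omega) ?_
    congr 2
    exact Tp.read_read (t := { t with inp := [] }) [conv a] (w.map conv)

/-- Phase `1` collects the entries of the distinguished tuple; the next separator, if there is one,
ends it. The final phase depends on whether a generator follows, so it is left existential. -/
theorem reach_read_one (B rest : List P.In) (hw : t.inp = B ++ rest)
    (hB : ∀ a ∈ B, (conv a).isEl = true) (hrest : ∀ a ∈ rest.head?, conv a = .sep) :
    ∃ ph', Reach O (.whilePop .inp conv (readBody c)) ⟨⟨r, s, 1, ok⟩, t.fn⟩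
      (9 * (B ++ rest).length + 2) ⟨⟨none, s, ph', ok⟩,
        (({ t with inp := [], bt := (B.map conv).reverse ++ t.bt } : Tp P Q _).read c
          (rest.map conv)).fn⟩ := by
  induction B generalizing t r with
  | nil =>
    cases rest with
    | nil =>
      refine ⟨1, (Reach.whilePop_nil hw).cast le_rfl ?_⟩
      have hw : t.inp = [] := hw
      simp only [List.map_nil, List.reverse_nil, List.nil_append, Tp.read, List.filterMap_nil,
        List.filter_nil]
      rw [← hw]
    | cons a w =>
      have ha : conv a = .sep := hrest a rfl
      have hb : Reach O (readBody c : TProg P Q (TupleSym Y)) ⟨⟨some (conv a), s, 1, ok⟩,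
          ({ t with inp := w } : Tp P Q _).fn⟩ 7
          ⟨⟨some (conv a), s, 2, ok⟩, (({ t with inp := w } : Tp P Q _).read c [conv a]).fn⟩ := by
        refine (Reach.eval (loopFree_readBody c) _).cast (cost_readBody c).le ?_
        rw [ha]
        simp [readBody, Prog.eval, TupleSym.entry, Tp.read]
        rfl
      refine ⟨2, (Reach.whilePop_cons hw (Tp.update_inp _ _) hb (reach_read_two w rfl)).cast
        (by simp; omega) ?_⟩
      congr 2
      exact Tp.read_read (t := { t with inp := [] }) [conv a] (w.map conv)
  | cons a B ih =>
    obtain ⟨ph', h⟩ := ih (t := { t with inp := B ++ rest, bt := conv a :: t.bt })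
      (r := some (conv a)) rfl fun a ha => hB a (List.mem_cons_of_mem _ ha)
    have hb : Reach O (readBody c : TProg P Q (TupleSym Y)) ⟨⟨some (conv a), s, 1, ok⟩,
        ({ t with inp := B ++ rest } : Tp P Q _).fn⟩ 7 ⟨⟨some (conv a), s, 1, ok⟩,
        ({ t with inp := B ++ rest, bt := conv a :: t.bt } : Tp P Q _).fn⟩ := by
      refine (Reach.eval (loopFree_readBody c) _).cast (cost_readBody c).le ?_
      simp [readBody, Prog.eval, hB a]
    exact ⟨ph', (Reach.whilePop_cons hw (Tp.update_inp _ _) hb h).cast (by simp; omega) (by simp [Tp.read])⟩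

/-- Phase `0` lasts through the unary length until the first separator, which is dropped. The copies
then hold the input without its first tuple, that is, the encoding of the generators alone. -/
theorem reach_read_zero (A B rest : List P.In) (a₀ : P.In) (hw : t.inp = A ++ a₀ :: (B ++ rest))
    (hA : ∀ a ∈ A, conv a = .unit) (ha₀ : conv a₀ = .sep)
    (hB : ∀ a ∈ B, (conv a).isEl = true) (hrest : ∀ a ∈ rest.head?, conv a = .sep) :
    ∃ ph', Reach O (.whilePop .inp conv (readBody c)) ⟨⟨r, s, 0, ok⟩, t.fn⟩
      (9 * (A ++ a₀ :: (B ++ rest)).length + 2) ⟨⟨none, s, ph', ok⟩,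
        (({ t with inp := [], bt := (B.map conv).reverse ++ t.bt } : Tp P Q _).read c
          ((A ++ rest).map conv)).fn⟩ := by
  induction A generalizing t r with
  | nil =>
    obtain ⟨ph', h⟩ := reach_read_one (O := O) (r := some (conv a₀)) (s := s) (ok := ok) (c := c)
      (t := { t with inp := B ++ rest }) B rest rfl hB hrest
    have hb : Reach O (readBody c : TProg P Q (TupleSym Y)) ⟨⟨some (conv a₀), s, 0, ok⟩,
        ({ t with inp := B ++ rest } : Tp P Q _).fn⟩ 7
        ⟨⟨some (conv a₀), s, 1, ok⟩, ({ t with inp := B ++ rest } : Tp P Q _).fn⟩ := by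
      refine (Reach.eval (loopFree_readBody c) _).cast (cost_readBody c).le ?_
      rw [ha₀]
      simp [readBody, Prog.eval]
    refine ⟨ph', (Reach.whilePop_cons hw (Tp.update_inp _ _) hb h).cast ?_ rfl⟩
    simp
    omega
  | cons a A ih =>
    have hb := reach_readBody_unit (O := O) (s := s) (ok := ok) (c := c) (ph := 0)
      (t := { t with inp := A ++ a₀ :: (B ++ rest) })
    rw [← hA a List.mem_cons_self] at hb
    obtain ⟨ph', h⟩ := ih (t := ({ t with inp := A ++ a₀ :: (B ++ rest) } : Tp P Q _).read c
      [conv a]) (r := some (conv a)) rfl fun a ha => hA a (List.mem_cons_of_mem _ ha)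
    refine ⟨ph', (Reach.whilePop_cons hw (Tp.update_inp _ _) hb h).cast (by simp; omega) ?_⟩
    congr 2
    exact Tp.read_read (t := { t with inp := [], bt := (B.map conv).reverse ++ t.bt }) [conv a]
      ((A ++ rest).map conv)

end Reading

/-! ### The two oracle calls and the shifted tuples -/

section Translating

variable {P : SearchProblem} {Q : Fin 2 → SearchProblem} {Y : Type}
  {O : ∀ i : Fin 2, List (Q i).In → List (Q i).Out}
  {t : Tp P Q (TupleSym Y)} {r s : Option (TupleSym Y)} {ph : Fin 3} {ok : Bool}

open scoped Classical

/-- The letter in the second register. -/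
def Mem.sreg (m : Mem (TupleSym Y)) : TupleSym Y := m.s.getD default

@[simp] theorem Mem.sreg_mk (a : TupleSym Y) :
    (⟨r, some a, ph, ok⟩ : Mem (TupleSym Y)).sreg = a := rfl

/-- Pop a work tape into the second register. -/
abbrev popReg (j : WT) : TProg P Q (TupleSym Y) :=
  .pop (.work j) fun m a => ⟨m.r, a, m.ph, m.ok⟩

/-- Clear the second register. -/
abbrev clearReg : TProg P Q (TupleSym Y) := .load fun m => ⟨m.r, none, m.ph, m.ok⟩

variable (addQ : TupleSym Y → TupleSym Y → (Q 0).In) (toQ : TupleSym Y → (Q 0).In)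

/-- Combine a letter with the next entry of the tape `ba`, which is rewound at separators. -/
def shiftBody : TProg P Q (TupleSym Y) :=
  .ite (fun m => m.reg.isEl)
    (.seq (popReg .ba) (.seq (.push (.work .st) fun m => m.sreg)
      (.seq (.push (.qry 0) fun m => addQ m.reg m.sreg) clearReg)))
    (.seq (.push (.qry 0) fun m => toQ m.reg) (.move (.work .st) (.work .ba) id id))

/-- A block of letters followed by a separator. -/
def blocks (ls : List (List (TupleSym Y))) : List (TupleSym Y) := ls.flatMap fun l => l ++ [.sep]

theorem blocks_cons (l : List (TupleSym Y)) (ls : List (List (TupleSym Y))) :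
    blocks (l :: ls) = l ++ .sep :: blocks ls := by simp [blocks]

variable {addQ toQ} {n : ℕ}

/-- The rest of the run is a hypothesis, so a block of entries can be prepended to it. The entries
`B` taken from `ba` are saved on `st` for reuse with the next tuple. -/
theorem reach_shift_els {u : Config (Tape.Letter P Q (TupleSym Y)) (Mem (TupleSym Y))}
    (l B : List (TupleSym Y)) {w rest : List (TupleSym Y)}
    (hl : ∀ a ∈ l, a.isEl = true) (hB : l.length = B.length)
    (hds : t.ds = l ++ w) (hba : t.ba = B ++ rest)
    (h : ∀ r', Reach O (.whilePop (.work .ds) id (shiftBody addQ toQ)) ⟨⟨r', none, ph, ok⟩,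
      ({ t with ds := w, ba := rest, st := B.reverse ++ t.st,
                q0 := (List.zipWith addQ l B).reverse ++ t.q0 } : Tp P Q _).fn⟩ n u) :
    Reach O (.whilePop (.work .ds) id (shiftBody addQ toQ)) ⟨⟨r, none, ph, ok⟩, t.fn⟩
      (7 * l.length + n) u := by
  induction l generalizing B t r with
  | nil =>
    obtain rfl : B = [] := List.length_eq_zero_iff.1 hB.symm
    have h' := h r
    have e : ({ t with ds := w, ba := rest } : Tp P Q _) = t := by
      rw [show w = t.ds from hds.symm, show rest = t.ba from hba.symm]
    simpa [e] using h'
  | cons a l ih =>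
    obtain ⟨b, B, rfl⟩ : ∃ b B', B = b :: B' := List.exists_cons_of_length_pos (by simp [← hB])
    have hb : Reach O (shiftBody addQ toQ : TProg P Q (TupleSym Y)) ⟨⟨some a, none, ph, ok⟩,
        ({ t with ds := l ++ w } : Tp P Q _).fn⟩ 5 ⟨⟨some a, none, ph, ok⟩,
        ({ t with ds := l ++ w, ba := B ++ rest, st := b :: t.st, q0 := addQ a b :: t.q0 } :
          Tp P Q _).fn⟩ := by
      rw [shiftBody]
      refine Reach.ite_true (by simp [hl a]) ((Reach.eval ?_ _).cast le_rfl ?_)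
      · simp [Prog.LoopFree]
      · simp [Prog.eval, hba]
    refine (Reach.whilePop_cons hds (Tp.update_ds _ _) hb (ih B
      (fun a ha => hl a (List.mem_cons_of_mem _ ha)) (by simpa using hB) rfl rfl ?_)).mono ?_
    · simpa using h
    · simp
      omega

/-- A block costs `7` steps per entry and `3` more per entry for restoring `ba` at its separator. -/
theorem reach_shift (ls : List (List (TupleSym Y))) (B : List (TupleSym Y))
    {rest : List (TupleSym Y)} (hl : ∀ l ∈ ls, ∀ a ∈ l, a.isEl = true)
    (hB : ∀ l ∈ ls, l.length = B.length) (hds : t.ds = blocks ls) (hba : t.ba = B ++ rest)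
    (hst : t.st = []) :
    Reach O (.whilePop (.work .ds) id (shiftBody addQ toQ)) ⟨⟨r, none, ph, ok⟩, t.fn⟩
      (ls.length * (10 * B.length + 6) + 2) ⟨⟨none, none, ph, ok⟩, ({ t with
        ds := [],
        q0 := (ls.reverse.flatMap fun l => toQ .sep :: (List.zipWith addQ l B).reverse) ++ t.q0 } :
          Tp P Q _).fn⟩ := by
  induction ls generalizing t r with
  | nil =>
    refine (Reach.whilePop_nil hds).cast (by simp) ?_
    cases t
    simp only [blocks, List.flatMap_nil] at hds
    simp [hds]
  | cons l ls ih =>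
    rw [blocks_cons] at hds
    refine (reach_shift_els (n := (3 * B.length + 4) + (ls.length * (10 * B.length + 6) + 2) + 2)
      l B (hl l List.mem_cons_self) (hB l List.mem_cons_self) hds hba fun r' => ?_).mono ?_
    · have hb : Reach O (shiftBody addQ toQ : TProg P Q (TupleSym Y)) ⟨⟨some .sep, none, ph, ok⟩,
          ({ t with ds := blocks ls, ba := rest, st := B.reverse ++ t.st,
                    q0 := (List.zipWith addQ l B).reverse ++ t.q0 } : Tp P Q _).fn⟩
          (3 * B.length + 4) ⟨⟨none, none, ph, ok⟩, ({ t with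
            ds := blocks ls,
            q0 := toQ .sep :: (List.zipWith addQ l B).reverse ++ t.q0 } : Tp P Q _).fn⟩ := by
        rw [shiftBody]
        refine Reach.cast (Reach.ite_false (by simp) (Reach.seq (Reach.push _ _ _ _)
          (Reach.move (by simp) _))) ?_ ?_
        · simp [hst]
          omega
        · simp [hst, ← hba]
      refine Reach.cast (Reach.whilePop_cons rfl (Tp.update_ds _ _) hb
        (ih (t := { t with
          ds := blocks ls,
          q0 := toQ .sep :: (List.zipWith addQ l B).reverse ++ t.q0 }) (fun l hl' => hl l (List.mem_cons_of_mem _ hl'))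
          (fun l hl' => hB l (List.mem_cons_of_mem _ hl')) rfl hba hst)) le_rfl ?_
      simp
    · rw [hB l List.mem_cons_self, List.length_cons]
      nlinarith

variable (toC : TupleSym Y → (Q 1).In) (cL : (Q 1).Out → TupleSym Y)

/-- Query the second oracle with the input, and the first one with the input followed by the
combinations of the tape `ba` with the tuples in the answer. -/
def translateProg (addQ : TupleSym Y → TupleSym Y → (Q 0).In) (toQ : TupleSym Y → (Q 0).In) :
    TProg P Q (TupleSym Y) :=
  .seq (.move (.work .c1) (.qry 1) id toC) <| .seq (.query 1) <|
  .seq (.move (.ans 1) (.work .ds) cL id) <|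
  .seq (.whilePop (.work .ds) id (shiftBody addQ toQ)) <|
  .seq (.move (.work .c2) (.qry 0) id toQ) (.query 0)

variable {toC cL}

/-- The oracle's answer arrives reversed on `ds`, so each tuple is read from its last entry and
closed by its separator, matching the reversed tuple on top of `ba`. Pushing onto the query tape
restores the order, and the copy of the input, moved last, comes to stand in front of the shifted
tuples. -/
theorem reach_translate {wr B rest : List (TupleSym Y)} {ls : List (List (TupleSym Y))}
    (hc1 : t.c1 = wr) (hc2 : t.c2 = wr) (hba : t.ba = B ++ rest) (hq0 : t.q0 = [])
    (hq1 : t.q1 = []) (hds : t.ds = []) (hst : t.st = [])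
    (hO : ((O 1 (wr.map toC).reverse).map cL).reverse = blocks ls)
    (hl : ∀ l ∈ ls, ∀ a ∈ l, a.isEl = true) (hB : ∀ l ∈ ls, l.length = B.length) :
    Reach O (translateProg toC cL addQ toQ) ⟨⟨r, none, ph, ok⟩, t.fn⟩
      (6 * wr.length + 3 * (blocks ls).length + ls.length * (10 * B.length + 6) + 10)
      ⟨⟨none, none, ph, ok⟩, ({ t with
        c1 := []
        c2 := []
        a1 := []
        a0 := O 0 ((wr.map toQ).reverse ++
          ls.reverse.flatMap fun l => toQ .sep :: (List.zipWith addQ l B).reverse) } :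
          Tp P Q _).fn⟩ := by
  have hlen : (O 1 (wr.map toC).reverse).length = (blocks ls).length := by
    rw [← hO]
    simp
  set w := ls.reverse.flatMap fun l => toQ .sep :: (List.zipWith addQ l B).reverse with hw
  have h1 : Reach O (.move (.work .c1) (.qry 1) id toC) ⟨⟨r, none, ph, ok⟩, t.fn⟩
      (3 * wr.length + 2) ⟨⟨none, none, ph, ok⟩,
      ({ t with c1 := [], q1 := (wr.map toC).reverse } : Tp P Q _).fn⟩ :=
    Reach.cast (Reach.move (by simp) _) (by simp [hc1]) (by simp [hc1, hq1])
  have h2 : Reach O (.query 1 : TProg P Q (TupleSym Y)) ⟨⟨none, none, ph, ok⟩,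
      ({ t with c1 := [], q1 := (wr.map toC).reverse } : Tp P Q _).fn⟩ 1 ⟨⟨none, none, ph, ok⟩,
      ({ t with c1 := [], a1 := O 1 (wr.map toC).reverse } : Tp P Q _).fn⟩ :=
    Reach.cast (Reach.query _ _ _) le_rfl (by simp [← hq1])
  have h3 : Reach O (.move (.ans 1) (.work .ds) cL id) ⟨⟨none, none, ph, ok⟩,
      ({ t with c1 := [], a1 := O 1 (wr.map toC).reverse } : Tp P Q _).fn⟩
      (3 * (blocks ls).length + 2) ⟨⟨none, none, ph, ok⟩,
      ({ t with c1 := [], a1 := [], ds := blocks ls } : Tp P Q _).fn⟩ :=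
    Reach.cast (Reach.move (by simp) _) (by simp [hlen]) (by simp [← hO, hds])
  have h4 := reach_shift (O := O) (addQ := addQ) (toQ := toQ) (r := none) (ph := ph) (ok := ok)
    (t := { t with c1 := [], a1 := [], ds := blocks ls }) ls B hl hB rfl hba hst
  have h5 : Reach O (.move (.work .c2) (.qry 0) id toQ) ⟨⟨none, none, ph, ok⟩,
      ({ t with c1 := [], a1 := [], ds := [], q0 := w ++ t.q0 } : Tp P Q _).fn⟩
      (3 * wr.length + 2) ⟨⟨none, none, ph, ok⟩,
      ({ t with c1 := [], c2 := [], a1 := [], q0 := (wr.map toQ).reverse ++ w } : Tp P Q _).fn⟩ :=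
    Reach.cast (Reach.move (by simp) _) (by simp [hc2]) (by simp [hc2, hq0, ← hds])
  have h6 := Reach.query (O := O) 0 (⟨none, none, ph, ok⟩ : Mem (TupleSym Y))
    ({ t with c1 := [], c2 := [], a1 := [], q0 := (wr.map toQ).reverse ++ w } : Tp P Q _).fn
  exact (h1.seq (h2.seq (h3.seq (h4.seq (h5.seq h6))))).cast (by omega) (by simp [← hq0])

end Translating

/-! ### The program that runs through all pairs of tuples -/

section Sifting

variable {P : SearchProblem} {Q : Fin 2 → SearchProblem} {Y : Type}
  {O : ∀ i : Fin 2, List (Q i).In → List (Q i).Out}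
  {t : Tp P Q (TupleSym Y)} {r s : Option (TupleSym Y)} {ph : Fin 3} {ok : Bool}

open scoped Classical

variable (setp setq : TupleSym Y → TupleSym Y → TupleSym Y)
  (upd : Bool → TupleSym Y → TupleSym Y → Bool) (fin : TupleSym Y → TupleSym Y)

/-- Enter a letter of the second tuple into the table `z`, updating the flag; at a separator,
rewind the table and apply `fin` if the flag is set. -/
def innerBody : TProg P Q (TupleSym Y) :=
  .seq (pushReg .qs2) <| .ite (fun m => m.reg.isEl)
    (.seq (popReg .z) <| .seq (.load fun m => ⟨m.r, m.s, m.ph, upd m.ok m.reg m.sreg⟩) <|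
      .seq (.push (.work .z2) fun m => setq m.reg m.sreg) clearReg)
    (.seq (.ite (fun m => m.ok) (.move (.work .z2) (.work .z) id fin)
        (.move (.work .z2) (.work .z) id id))
      (.load fun m => ⟨m.r, m.s, m.ph, false⟩))

/-- Run through all second tuples. -/
def innerLoop : TProg P Q (TupleSym Y) := .whilePop (.work .qs) id (innerBody setq upd fin)

/-- The final value of the flag. -/
def flag (l z : List (TupleSym Y)) (ok : Bool) : Bool :=
  (l.zip z).foldl (fun ok a => upd ok a.1 a.2) ok

/-- The effect of a second tuple on the table. -/
def innerStep (z l : List (TupleSym Y)) : List (TupleSym Y) :=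
  if flag upd l z false then (List.zipWith setq l z).map fin else List.zipWith setq l z

/-- The effect of a first tuple on the table. -/
def outerStep (ls : List (List (TupleSym Y))) (z l : List (TupleSym Y)) : List (TupleSym Y) :=
  ls.foldl (innerStep setq upd fin) (List.zipWith setp l z)

/-- Enter a letter of the first tuple into the table `z`; at a separator, rewind the table and
run through all second tuples. -/
def outerBody : TProg P Q (TupleSym Y) :=
  .seq (pushReg .ps2) <| .ite (fun m => m.reg.isEl)
    (.seq (popReg .z) <| .seq (.push (.work .z2) fun m => setp m.reg m.sreg) clearReg)
    (.seq (.move (.work .z2) (.work .z) id id) <|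
      .seq (innerLoop setq upd fin) (.move (.work .qs2) (.work .qs) id id))

/-- Run through all first tuples. -/
def outerLoop : TProg P Q (TupleSym Y) :=
  .whilePop (.work .ps) id (outerBody setp setq upd fin)

/-- Run through all pairs of tuples as often as there are letters on `kt`. -/
def passes : TProg P Q (TupleSym Y) :=
  .whilePop (.work .kt) id (.seq (outerLoop setp setq upd fin)
    (.move (.work .ps2) (.work .ps) id id))

variable {setp setq upd fin} {n : ℕ}

theorem length_innerStep {z l : List (TupleSym Y)} (h : l.length = z.length) :
    (innerStep setq upd fin z l).length = z.length := by
  unfold innerStep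
  split_ifs <;> simp [h]

theorem length_outerStep {ls : List (List (TupleSym Y))} {z l : List (TupleSym Y)}
    (h : l.length = z.length) (hls : ∀ l ∈ ls, l.length = z.length) :
    (outerStep setp setq upd fin ls z l).length = z.length := by
  unfold outerStep
  have h0 : (List.zipWith setp l z).length = z.length := by simp [h]
  generalize List.zipWith setp l z = z' at h0
  induction ls generalizing z' with
  | nil => exact h0
  | cons a ls ih =>
    refine ih (fun l hl => hls l (List.mem_cons_of_mem _ hl)) _ ?_
    rw [length_innerStep, h0]
    rw [hls a List.mem_cons_self, h0]

theorem length_pass {ls : List (List (TupleSym Y))} {z : List (TupleSym Y)}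
    (hls : ∀ l ∈ ls, l.length = z.length) :
    (ls.foldl (outerStep setp setq upd fin ls) z).length = z.length := by
  have key : ∀ (ls' : List (List (TupleSym Y))) (z' : List (TupleSym Y)),
      (∀ l ∈ ls', l.length = z.length) → z'.length = z.length →
      (ls'.foldl (outerStep setp setq upd fin ls) z').length = z.length := by
    intro ls'
    induction ls' with
    | nil => exact fun _ _ h => h
    | cons l ls' ih =>
      intro z' h hz'
      refine ih _ (fun l hl => h l (List.mem_cons_of_mem _ hl)) ?_
      rw [length_outerStep, hz']
      · rw [h l List.mem_cons_self, hz']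
      · intro l hl
        rw [hls l hl, hz']
  exact key ls z hls rfl

theorem length_passes {ls : List (List (TupleSym Y))} {z : List (TupleSym Y)}
    (hls : ∀ l ∈ ls, l.length = z.length) (n : ℕ) :
    ((fun z => ls.foldl (outerStep setp setq upd fin ls) z)^[n] z).length = z.length := by
  induction n with
  | zero => rfl
  | succ n ih =>
    rw [Function.iterate_succ_apply', length_pass fun l hl => (hls l hl).trans ih.symm, ih]

theorem length_blocks {ls : List (List (TupleSym Y))} {k : ℕ} (h : ∀ l ∈ ls, l.length = k) :
    (blocks ls).length = ls.length * (k + 1) := by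
  induction ls with
  | nil => simp [blocks]
  | cons l ls ih =>
    rw [blocks_cons, List.length_append, List.length_cons,
      ih fun l hl => h l (List.mem_cons_of_mem _ hl), h l List.mem_cons_self, List.length_cons]
    ring

/-- The table migrates from `z` to `z2` while the flag accumulates; the decision whether to apply
`fin` waits for the separator, when the whole tuple has been seen. -/
theorem reach_inner_els {u : Config (Tape.Letter P Q (TupleSym Y)) (Mem (TupleSym Y))}
    (l : List (TupleSym Y)) {w : List (TupleSym Y)}
    (hl : ∀ a ∈ l, a.isEl = true) (hz : l.length = t.z.length) (hqs : t.qs = l ++ w)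
    (h : ∀ r', Reach O (innerLoop setq upd fin) ⟨⟨r', none, ph, flag upd l t.z ok⟩,
      ({ t with qs := w, qs2 := l.reverse ++ t.qs2, z := [],
                z2 := (List.zipWith setq l t.z).reverse ++ t.z2 } : Tp P Q _).fn⟩ n u) :
    Reach O (innerLoop setq upd fin) ⟨⟨r, none, ph, ok⟩, t.fn⟩ (8 * l.length + n) u := by
  induction l generalizing t r ok with
  | nil =>
    have h' := h r
    have hz : t.z = [] := List.length_eq_zero_iff.1 hz.symm
    have e : ({ t with qs := w, z := [] } : Tp P Q _) = t := by
      rw [show w = t.qs from hqs.symm, ← hz]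
    simpa [e, flag] using h'
  | cons a l ih =>
    obtain ⟨b, z, hbz⟩ : ∃ b z, t.z = b :: z := List.exists_cons_of_length_pos (by simp [← hz])
    have hb : Reach O (innerBody setq upd fin : TProg P Q (TupleSym Y)) ⟨⟨some a, none, ph, ok⟩,
        ({ t with qs := l ++ w } : Tp P Q _).fn⟩ 6 ⟨⟨some a, none, ph, upd ok a b⟩,
        ({ t with qs := l ++ w, qs2 := a :: t.qs2, z := z, z2 := setq a b :: t.z2 } :
          Tp P Q _).fn⟩ := by
      rw [innerBody]
      refine (Reach.push _ _ _ _).seq (n := 5) (Reach.ite_true (by simp [hl a])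
        ((Reach.eval ?_ _).cast le_rfl ?_))
      · simp [Prog.LoopFree]
      · simp [Prog.eval, hbz]
    refine Reach.mono (Reach.whilePop_cons hqs (Tp.update_qs _ _) hb (ih
      (fun a ha => hl a (List.mem_cons_of_mem _ ha)) ?_ rfl ?_)) ?_
    · simpa [hbz] using hz
    · simpa [hbz, flag] using h
    · simp
      omega

theorem reach_inner (ls : List (List (TupleSym Y))) {k : ℕ} (hk : t.z.length = k)
    (hl : ∀ l ∈ ls, ∀ a ∈ l, a.isEl = true)
    (hz : ∀ l ∈ ls, l.length = k) (hqs : t.qs = blocks ls) (hz2 : t.z2 = []) :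
    Reach O (innerLoop setq upd fin) ⟨⟨r, none, ph, false⟩, t.fn⟩
      (ls.length * (11 * k + 8) + 2) ⟨⟨none, none, ph, false⟩, ({ t with
        qs := []
        qs2 := (blocks ls).reverse ++ t.qs2
        z := ls.foldl (innerStep setq upd fin) t.z } : Tp P Q _).fn⟩ := by
  induction ls generalizing t r with
  | nil =>
    refine (Reach.whilePop_nil hqs).cast (by simp) ?_
    cases t
    simp only [blocks, List.flatMap_nil] at hqs
    simp [hqs, blocks]
  | cons l ls ih =>
    rw [blocks_cons] at hqs
    have hlk := hz l List.mem_cons_self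
    refine (reach_inner_els (n := (3 * k + 6) + (ls.length * (11 * k + 8) + 2) + 2)
      l (hl l List.mem_cons_self) (hlk.trans hk.symm) hqs fun r' => ?_).mono ?_
    · have hb : Reach O (innerBody setq upd fin : TProg P Q (TupleSym Y))
          ⟨⟨some .sep, none, ph, flag upd l t.z false⟩,
          ({ t with qs := blocks ls, qs2 := l.reverse ++ t.qs2, z := [],
                    z2 := (List.zipWith setq l t.z).reverse ++ t.z2 } : Tp P Q _).fn⟩
          (3 * k + 6) ⟨⟨none, none, ph, false⟩, ({ t with
            qs := blocks ls, qs2 := .sep :: l.reverse ++ t.qs2,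
            z := innerStep setq upd fin t.z l } : Tp P Q _).fn⟩ := by
        rw [innerBody, innerStep]
        cases hf : flag upd l t.z false with
        | true =>
          refine Reach.cast (Reach.seq (Reach.push _ _ _ _) (Reach.ite_false (by simp)
            (Reach.seq (Reach.ite_true (by simp) (Reach.move (by simp) _))
              (Reach.load _ _ _)))) ?_ ?_
          · simp [hz2, hk, hlk]
            omega
          · simp [hz2]
        | false =>
          refine Reach.cast (Reach.seq (Reach.push _ _ _ _) (Reach.ite_false (by simp)
            (Reach.seq (Reach.ite_false (by simp) (Reach.move (by simp) _))
              (Reach.load _ _ _)))) ?_ ?_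
          · simp [hz2, hk, hlk]
            omega
          · simp [hz2]
      refine Reach.cast (Reach.whilePop_cons rfl (Tp.update_qs _ _) hb
        (ih (t := { t with
            qs := blocks ls, qs2 := .sep :: l.reverse ++ t.qs2,
            z := innerStep setq upd fin t.z l }) ?_ (fun l hl' => hl l (List.mem_cons_of_mem _ hl'))
          (fun l hl' => hz l (List.mem_cons_of_mem _ hl')) rfl hz2)) le_rfl ?_
      · exact (length_innerStep (hlk.trans hk.symm)).trans hk
      · simp [blocks_cons]
    · rw [hlk, List.length_cons]
      nlinarith

theorem reach_outer_els {u : Config (Tape.Letter P Q (TupleSym Y)) (Mem (TupleSym Y))}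
    (l : List (TupleSym Y)) {w : List (TupleSym Y)}
    (hl : ∀ a ∈ l, a.isEl = true) (hz : l.length = t.z.length) (hps : t.ps = l ++ w)
    (h : ∀ r', Reach O (outerLoop setp setq upd fin) ⟨⟨r', none, ph, ok⟩,
      ({ t with ps := w, ps2 := l.reverse ++ t.ps2, z := [],
                z2 := (List.zipWith setp l t.z).reverse ++ t.z2 } : Tp P Q _).fn⟩ n u) :
    Reach O (outerLoop setp setq upd fin) ⟨⟨r, none, ph, ok⟩, t.fn⟩ (7 * l.length + n) u := by
  induction l generalizing t r with
  | nil =>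
    have h' := h r
    have hz : t.z = [] := List.length_eq_zero_iff.1 hz.symm
    have e : ({ t with ps := w, z := [] } : Tp P Q _) = t := by
      rw [show w = t.ps from hps.symm, ← hz]
    simpa [e] using h'
  | cons a l ih =>
    obtain ⟨b, z, hbz⟩ : ∃ b z, t.z = b :: z := List.exists_cons_of_length_pos (by simp [← hz])
    have hb : Reach O (outerBody setp setq upd fin : TProg P Q (TupleSym Y))
        ⟨⟨some a, none, ph, ok⟩, ({ t with ps := l ++ w } : Tp P Q _).fn⟩ 5
        ⟨⟨some a, none, ph, ok⟩,
        ({ t with ps := l ++ w, ps2 := a :: t.ps2, z := z, z2 := setp a b :: t.z2 } :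
          Tp P Q _).fn⟩ := by
      rw [outerBody]
      refine (Reach.push _ _ _ _).seq (n := 4) (Reach.ite_true (by simp [hl a])
        ((Reach.eval ?_ _).cast le_rfl ?_))
      · simp [Prog.LoopFree]
      · simp [Prog.eval, hbz]
    refine Reach.mono (Reach.whilePop_cons hps (Tp.update_ps _ _) hb (ih
      (fun a ha => hl a (List.mem_cons_of_mem _ ha)) ?_ rfl ?_)) ?_
    · simpa [hbz] using hz
    · simpa [hbz] using h
    · simp
      omega

/-- For each first tuple, a second tuple costs `11 k + 8` steps in the inner loop and `3 (k + 1)`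
steps when `qs` is restored from `qs2`, which gives `14 k + 11`. -/
theorem reach_outer (ls ls' : List (List (TupleSym Y))) {k : ℕ} (hk : t.z.length = k)
    (hl : ∀ l ∈ ls, ∀ a ∈ l, a.isEl = true) (hz : ∀ l ∈ ls, l.length = k)
    (hl' : ∀ l ∈ ls', ∀ a ∈ l, a.isEl = true) (hz' : ∀ l ∈ ls', l.length = k)
    (hps : t.ps = blocks ls) (hqs : t.qs = blocks ls') (hqs2 : t.qs2 = []) (hz2 : t.z2 = []) :
    Reach O (outerLoop setp setq upd fin) ⟨⟨r, none, ph, false⟩, t.fn⟩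
      (ls.length * (10 * k + 10 + ls'.length * (14 * k + 11)) + 2)
      ⟨⟨none, none, ph, false⟩, ({ t with
        ps := []
        ps2 := (blocks ls).reverse ++ t.ps2
        z := ls.foldl (outerStep setp setq upd fin ls') t.z } : Tp P Q _).fn⟩ := by
  induction ls generalizing t r with
  | nil =>
    refine (Reach.whilePop_nil hps).cast (by simp) ?_
    cases t
    simp only [blocks, List.flatMap_nil] at hps
    simp [hps, blocks]
  | cons l ls ih =>
    rw [blocks_cons] at hps
    have hlk := hz l List.mem_cons_self
    refine (reach_outer_els
      (n := (3 * k + 8 + ls'.length * (14 * k + 11)) +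
        (ls.length * (10 * k + 10 + ls'.length * (14 * k + 11)) + 2) + 2)
      l (hl l List.mem_cons_self) (hlk.trans hk.symm) hps fun r' => ?_).mono ?_
    · have h1 := reach_inner (O := O) (setq := setq) (upd := upd) (fin := fin) (r := none)
        (ph := ph) (t := { t with ps := blocks ls, ps2 := .sep :: l.reverse ++ t.ps2,
                                  z := List.zipWith setp l t.z }) ls' (k := k)
        (by simp [hlk, hk]) hl' hz' hqs hz2
      have hb : Reach O (outerBody setp setq upd fin : TProg P Q (TupleSym Y))
          ⟨⟨some .sep, none, ph, false⟩,
          ({ t with ps := blocks ls, ps2 := l.reverse ++ t.ps2, z := [],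
                    z2 := (List.zipWith setp l t.z).reverse ++ t.z2 } : Tp P Q _).fn⟩
          (3 * k + 8 + ls'.length * (14 * k + 11)) ⟨⟨none, none, ph, false⟩, ({ t with
            ps := blocks ls, ps2 := .sep :: l.reverse ++ t.ps2,
            z := outerStep setp setq upd fin ls' t.z l } : Tp P Q _).fn⟩ := by
        rw [outerBody, outerStep]
        refine Reach.cast (Reach.seq (Reach.push _ _ _ _) (Reach.ite_false (by simp)
            (Reach.seq (Reach.cast (Reach.move (by simp) _) (n := 3 * k + 2) ?_ ?_)
              (Reach.seq h1 (Reach.move (by simp) _))))) ?_ ?_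
        · simp [hz2, hk, hlk]
        · simp [hz2]
        · simp [hqs2, length_blocks hz']
          nlinarith
        · simp [hqs2, ← hqs]
      refine Reach.cast (Reach.whilePop_cons rfl (Tp.update_ps _ _) hb
        (ih (t := { t with
            ps := blocks ls, ps2 := .sep :: l.reverse ++ t.ps2,
            z := outerStep setp setq upd fin ls' t.z l }) ?_
          (fun l hl' => hl l (List.mem_cons_of_mem _ hl'))
          (fun l hl' => hz l (List.mem_cons_of_mem _ hl')) rfl hqs hqs2 hz2)) le_rfl ?_
      · exact (length_outerStep (hlk.trans hk.symm) fun l hl => (hz' l hl).trans hk.symm).trans hk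
      · simp [blocks_cons]
    · rw [hlk, List.length_cons]
      nlinarith

/-- Restoring `ps` from `ps2` after a pass adds `3 (k + 1)` steps per tuple, which raises `10 k +
10` to `13 k + 13`. -/
theorem reach_passes (ls : List (List (TupleSym Y))) {k : ℕ} (kt : List (TupleSym Y))
    (hk : t.z.length = k) (hkt : t.kt = kt)
    (hl : ∀ l ∈ ls, ∀ a ∈ l, a.isEl = true) (hz : ∀ l ∈ ls, l.length = k)
    (hps : t.ps = blocks ls) (hqs : t.qs = blocks ls) (hqs2 : t.qs2 = []) (hz2 : t.z2 = [])
    (hps2 : t.ps2 = []) :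
    Reach O (passes setp setq upd fin) ⟨⟨r, none, ph, false⟩, t.fn⟩
      (kt.length * (ls.length * (13 * k + 13 + ls.length * (14 * k + 11)) + 6) + 2)
      ⟨⟨none, none, ph, false⟩, ({ t with
        kt := []
        z := (fun z => ls.foldl (outerStep setp setq upd fin ls) z)^[kt.length] t.z } :
          Tp P Q _).fn⟩ := by
  induction kt generalizing t r with
  | nil =>
    refine (Reach.whilePop_nil hkt).cast (by simp) ?_
    cases t
    simp only at hkt
    simp [hkt]
  | cons a kt ih =>
    have h1 := reach_outer (O := O) (setp := setp) (setq := setq) (upd := upd) (fin := fin)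
      (r := some a) (ph := ph) (t := { t with kt := kt }) ls ls hk hl hz hl hz hps hqs hqs2 hz2
    have hb : Reach O (.seq (outerLoop setp setq upd fin)
        (.move (.work .ps2) (.work .ps) id id) : TProg P Q (TupleSym Y))
        ⟨⟨some a, none, ph, false⟩, ({ t with kt := kt } : Tp P Q _).fn⟩
        (ls.length * (13 * k + 13 + ls.length * (14 * k + 11)) + 4)
        ⟨⟨none, none, ph, false⟩, ({ t with
          kt := kt, z := ls.foldl (outerStep setp setq upd fin ls) t.z } : Tp P Q _).fn⟩ := by
      refine Reach.cast (Reach.seq h1 (Reach.move (by simp) _)) ?_ ?_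
      · simp [hps2, length_blocks hz]
        nlinarith
      · simp [hps2, ← hps]
    refine Reach.cast (Reach.whilePop_cons hkt (Tp.update_kt _ _) hb
      (ih (t := { t with
          kt := kt, z := ls.foldl (outerStep setp setq upd fin ls) t.z }) ?_ rfl hps hqs hqs2
        hz2 hps2)) ?_ ?_
    · exact (length_pass fun l hl => (hz l hl).trans hk.symm).trans hk
    · rw [List.length_cons]
      nlinarith
    · simp

end Sifting

/-! ### Membership by sifting through a set with full signature -/

section Sift

theorem List.foldl_induction {α β : Type*} {f : β → α → β} {l : List α} {J : β → Prop}
    (hJ : ∀ a ∈ l, ∀ x, J x → J (f x a)) {x : β} (hx : J x) : J (l.foldl f x) := by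
  induction l generalizing x with
  | nil => exact hx
  | cons a l ih =>
    exact ih (fun a ha => hJ a (List.mem_cons_of_mem _ ha)) (hJ a List.mem_cons_self x hx)

/-- The invariant `J` survives until `b` is met, where it becomes `K`, which then survives to the
end. It allows one good pair to be singled out among all the pairs of a pass. -/
theorem List.foldl_reach {α β : Type*} {f : β → α → β} {l : List α} {J K : β → Prop}
    (hJ : ∀ a ∈ l, ∀ x, J x → J (f x a)) (hK : ∀ a ∈ l, ∀ x, K x → K (f x a)) {b : α} (hb : b ∈ l)
    (hJK : ∀ x, J x → K (f x b)) {x : β} (hx : J x) : K (l.foldl f x) := by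
  obtain ⟨l₁, l₂, rfl⟩ := List.append_of_mem hb
  rw [List.foldl_append, List.foldl_cons]
  refine List.foldl_induction (fun a ha => hK a (by simp [ha])) (hJK _ ?_)
  exact List.foldl_induction (fun a ha => hJ a (by simp [ha])) hx

variable {A : Type} {k : ℕ}

/-- At the first difference of `p` and `q`, they agree with `x` and `b` respectively. -/
def ForkAt (b p q x : Fin k → A) : Prop :=
  ∃ i, (∀ j < i, p j = q j) ∧ p i ≠ q i ∧ p i = x i ∧ q i = b i

open scoped Classical in
/-- Use the pair `p, q` to correct the first difference of `x` from `b`. -/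
noncomputable def siftStep (μ : A → A → A → A) (b p x q : Fin k → A) : Fin k → A :=
  if ForkAt b p q x then fun j => μ (p j) (q j) (x j) else x

/-- Use all pairs of elements of `S` to correct `x`. -/
noncomputable def siftPass (μ : A → A → A → A) (b : Fin k → A) (S : List (Fin k → A))
    (x : Fin k → A) : Fin k → A :=
  S.foldl (fun x p => S.foldl (siftStep μ b p) x) x

variable {μ : A → A → A → A} {b : Fin k → A} {S : List (Fin k → A)} {W : Set (Fin k → A)}

/-- Where `x` already agrees with `b`, a pair that forks properly cannot differ for the first time,
so a step never spoils the correct initial segment. The entry just after it is either untouched or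
corrected. -/
theorem siftStep_agree (h₁ : ∀ p x, μ p p x = x) (h₂ : ∀ q x, μ x q x = q) {p q x : Fin k → A}
    {i : ℕ} (hx : ∀ j : Fin k, j < i → x j = b j) :
    (∀ j : Fin k, j < i → siftStep μ b p x q j = b j) ∧
      ∀ hi : i < k, siftStep μ b p x q ⟨i, hi⟩ = x ⟨i, hi⟩ ∨
        siftStep μ b p x q ⟨i, hi⟩ = b ⟨i, hi⟩ := by
  unfold siftStep
  split_ifs with h
  · obtain ⟨i₀, hlt, hne, hp, hq⟩ := h
    have hi₀ : i ≤ i₀ := by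
      by_contra! h
      exact hne (by rw [hp, hq, hx i₀ h])
    refine ⟨fun j hj => ?_, fun hi => ?_⟩
    · simp only
      rw [hlt j (Fin.lt_def.2 (hj.trans_le hi₀)), h₁, hx j hj]
    · rcases hi₀.lt_or_eq with h | h
      · left
        simp only
        rw [hlt ⟨i, hi⟩ (Fin.lt_def.2 h), h₁]
      · right
        obtain rfl : i₀ = ⟨i, hi⟩ := Fin.ext h.symm
        simp only
        rw [hp, hq, h₂]
  · exact ⟨hx, fun _ => Or.inl rfl⟩

theorem siftStep_fork (h₁ : ∀ p x, μ p p x = x) (h₂ : ∀ q x, μ x q x = q) {p q x : Fin k → A}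
    {i : Fin k} (hx : ∀ j < i, x j = b j) (hpq : ∀ j < i, p j = q j) (hp : p i = x i)
    (hq : q i = b i) : siftStep μ b p x q i = b i := by
  by_cases hne : p i = q i
  · have hxb : x i = b i := by rw [← hp, hne, hq]
    rcases (siftStep_agree (q := q) (p := p) h₁ h₂ (i := i) fun j hj => hx j hj).2 i.2 with h | h
    · exact h.trans hxb
    · exact h
  · rw [siftStep, if_pos ⟨i, hpq, hne, hp, hq⟩]
    rw [hp, hq, h₂]

theorem siftStep_mem (hW : ∀ p ∈ W, ∀ q ∈ W, ∀ x ∈ W, (fun j => μ (p j) (q j) (x j)) ∈ W)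
    {p q x : Fin k → A} (hp : p ∈ W) (hq : q ∈ W) (hx : x ∈ W) : siftStep μ b p x q ∈ W := by
  unfold siftStep
  split_ifs
  · exact hW p hp q hq x hx
  · exact hx

theorem siftPass_mem (hW : ∀ p ∈ W, ∀ q ∈ W, ∀ x ∈ W, (fun j => μ (p j) (q j) (x j)) ∈ W)
    (hS : ∀ p ∈ S, p ∈ W) {x : Fin k → A} (hx : x ∈ W) : siftPass μ b S x ∈ W :=
  List.foldl_induction (J := (· ∈ W)) (fun p hp _ hx => List.foldl_induction (J := (· ∈ W))
    (fun q hq _ hx => siftStep_mem hW (hS p hp) (hS q hq) hx) hx) hx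

/-- The signature supplies a pair `p, q` in `S` for `(i, x i, b i)`, chosen for the value of `x` at
the start of the pass. Until that pair is reached, entry `i` is still `x i` or has already become `b
i`, and in both cases it is correct afterwards. -/
theorem siftPass_agree (h₁ : ∀ p x, μ p p x = x) (h₂ : ∀ q x, μ x q x = q)
    (hsig : Sig W ⊆ Sig {p | p ∈ S}) (hb : b ∈ W) {x : Fin k → A} (hxW : x ∈ W)
    {i : Fin k} (hx : ∀ j < i, x j = b j) : ∀ j ≤ i, siftPass μ b S x j = b j := by
  obtain ⟨p, hp, q, hq, hpq, hpx, hqb⟩ := hsig (show (i, x i, b i) ∈ Sig W from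
    ⟨x, hxW, b, hb, hx, rfl, rfl⟩)
  set J : (Fin k → A) → Prop := fun y => (∀ j < i, y j = b j) ∧ (y i = x i ∨ y i = b i)
  set K : (Fin k → A) → Prop := fun y => ∀ j ≤ i, y j = b j
  have hJ : ∀ p q y, J y → J (siftStep μ b p y q) := by
    rintro p q y ⟨hy, hyi⟩
    obtain ⟨h, h'⟩ := siftStep_agree (q := q) (p := p) h₁ h₂ (i := i) fun j hj => hy j hj
    refine ⟨fun j hj => h j hj, ?_⟩
    rcases h' i.2 with h' | h'
    · rwa [show siftStep μ b p y q i = y i from h']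
    · exact Or.inr h'
  have hK : ∀ p q y, K y → K (siftStep μ b p y q) := by
    intro p q y hy j hj
    exact (siftStep_agree (q := q) (p := p) h₁ h₂ (i := i + 1)
      fun j hj => hy j (Fin.le_def.2 (Nat.lt_succ_iff.1 hj))).1 j (Nat.lt_succ_iff.2 hj)
  have hJK : ∀ y, J y → K (siftStep μ b p y q) := by
    rintro y ⟨hy, hyi⟩ j hj
    rcases hj.lt_or_eq with hj | rfl
    · exact (hJ p q y ⟨hy, hyi⟩).1 j hj
    · rcases hyi with hyi | hyi
      · exact siftStep_fork h₁ h₂ hy hpq (hpx.trans hyi.symm) hqb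
      -- An earlier pair has already corrected entry `i`, and further steps preserve it.
      · exact hK p q y (fun j' hj' => hj'.lt_or_eq.elim (hy j') fun h => h ▸ hyi) j le_rfl
  exact List.foldl_reach (J := J) (K := K)
    (fun p _ y hy => List.foldl_induction (fun q _ y hy => hJ p q y hy) hy)
    (fun p _ y hy => List.foldl_induction (fun q _ y hy => hK p q y hy) hy) hp
    (fun y hy => List.foldl_reach (fun q _ y hy => hJ p q y hy) (fun q _ y hy => hK p q y hy) hq
      hJK hy) ⟨hx, Or.inl rfl⟩

/-- All iterates stay in `W`, which gives one direction. If `b` is in `W`, each pass fixes at least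
one more coordinate, so `k` passes suffice. -/
theorem mem_iff_siftPass (h₁ : ∀ p x, μ p p x = x) (h₂ : ∀ q x, μ x q x = q)
    (hW : ∀ p ∈ W, ∀ q ∈ W, ∀ x ∈ W, (fun j => μ (p j) (q j) (x j)) ∈ W)
    (hS : ∀ p ∈ S, p ∈ W) (hsig : Sig W ⊆ Sig {p | p ∈ S}) {x : Fin k → A} (hx : x ∈ W) :
    b ∈ W ↔ (siftPass μ b S)^[k] x = b := by
  have hmem : ∀ n, (siftPass μ b S)^[n] x ∈ W := by
    intro n
    induction n with
    | zero => exact hx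
    | succ n ih =>
      rw [Function.iterate_succ_apply']
      exact siftPass_mem hW hS ih
  refine ⟨fun hb => ?_, fun h => h ▸ hmem k⟩
  have : ∀ n ≤ k, ∀ j : Fin k, j.1 < n → (siftPass μ b S)^[n] x j = b j := by
    intro n
    induction n with
    | zero => exact fun _ j hj => absurd hj (Nat.not_lt_zero _)
    | succ n ih =>
      intro hn j hj
      rw [Function.iterate_succ_apply']
      exact siftPass_agree h₁ h₂ hsig hb (hmem n) (i := ⟨n, hn⟩) (fun j hj => ih (by omega) j hj) j
        (Fin.le_def.2 (Nat.lt_succ_iff.1 hj))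
  exact funext fun j => this k le_rfl j j.2

end Sift

/-! ### The complete membership test on the machine -/

section Programs

variable {P : SearchProblem} {Q : Fin 2 → SearchProblem} {Y : Type}
  {O : ∀ i : Fin 2, List (Q i).In → List (Q i).Out}
  {t : Tp P Q (TupleSym Y)} {r s : Option (TupleSym Y)} {ph : Fin 3} {ok : Bool}

open scoped Classical

/-- Copy the answer of the first oracle to the tapes `ps` and `qs`. -/
def copyAnswer (cA : (Q 0).Out → TupleSym Y) : TProg P Q (TupleSym Y) :=
  .whilePop (.ans 0) cA (.seq (pushReg .ps) (pushReg .qs))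

/-- Combine the tapes `bt` and `ba` to the initial table. -/
def initTable (mk : TupleSym Y → TupleSym Y → TupleSym Y) : TProg P Q (TupleSym Y) :=
  .whilePop (.work .bt) id
    (.seq (popReg .ba) (.seq (.push (.work .z2) fun m => mk m.reg m.sreg) clearReg))

/-- Check all entries of the table. -/
def checkTable (good : TupleSym Y → Bool) : TProg P Q (TupleSym Y) :=
  .whilePop (.work .z) id (.load fun m => ⟨m.r, m.s, m.ph, m.ok && good m.reg⟩)

variable {cA : (Q 0).Out → TupleSym Y} {mk : TupleSym Y → TupleSym Y → TupleSym Y}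
  {good : TupleSym Y → Bool}

theorem reach_copyAnswer (w : List (Q 0).Out) (hw : t.a0 = w) :
    Reach O (copyAnswer cA) ⟨⟨r, s, ph, ok⟩, t.fn⟩ (4 * w.length + 2) ⟨⟨none, s, ph, ok⟩,
      ({ t with a0 := [], ps := (w.map cA).reverse ++ t.ps, qs := (w.map cA).reverse ++ t.qs } :
        Tp P Q _).fn⟩ := by
  induction w generalizing t r with
  | nil =>
    refine (Reach.whilePop_nil hw).cast le_rfl ?_
    cases t
    simp only at hw
    simp [hw]
  | cons a w ih =>
    have hb : Reach O (.seq (pushReg .ps) (pushReg .qs) : TProg P Q (TupleSym Y))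
        ⟨⟨some (cA a), s, ph, ok⟩, ({ t with a0 := w } : Tp P Q _).fn⟩ 2
        ⟨⟨some (cA a), s, ph, ok⟩,
          ({ t with a0 := w, ps := cA a :: t.ps, qs := cA a :: t.qs } : Tp P Q _).fn⟩ :=
      Reach.cast (Reach.eval (by simp [Prog.LoopFree]) _) le_rfl (by simp [Prog.eval])
    refine Reach.cast (Reach.whilePop_cons hw (Tp.update_a0 _ _) hb (ih rfl)) ?_ ?_
    · simp
      omega
    · simp

theorem reach_initTable (l B : List (TupleSym Y)) {rest : List (TupleSym Y)}
    (hlB : l.length = B.length) (hl : t.bt = l) (hB : t.ba = B ++ rest) :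
    Reach O (initTable mk) ⟨⟨r, none, ph, ok⟩, t.fn⟩ (5 * l.length + 2) ⟨⟨none, none, ph, ok⟩,
      ({ t with bt := [], ba := rest, z2 := (List.zipWith mk l B).reverse ++ t.z2 } :
        Tp P Q _).fn⟩ := by
  induction l generalizing t r B with
  | nil =>
    refine (Reach.whilePop_nil hl).cast le_rfl ?_
    obtain rfl : B = [] := List.length_eq_zero_iff.1 hlB.symm
    cases t
    simp only [List.nil_append] at hl hB
    simp [hl, hB]
  | cons a l ih =>
    obtain ⟨b, B, rfl⟩ : ∃ b B', B = b :: B' := List.exists_cons_of_length_pos (by simp [← hlB])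
    have hb : Reach O (.seq (popReg .ba)
        (.seq (.push (.work .z2) fun m => mk m.reg m.sreg) clearReg) : TProg P Q (TupleSym Y))
        ⟨⟨some a, none, ph, ok⟩, ({ t with bt := l } : Tp P Q _).fn⟩ 3
        ⟨⟨some a, none, ph, ok⟩,
          ({ t with bt := l, ba := B ++ rest, z2 := mk a b :: t.z2 } : Tp P Q _).fn⟩ :=
      Reach.cast (Reach.eval (by simp [Prog.LoopFree]) _) le_rfl (by simp [Prog.eval, hB])
    refine Reach.cast (Reach.whilePop_cons hl (Tp.update_bt _ _) hb
      (ih B (by simpa using hlB) rfl rfl)) ?_ ?_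
    · simp
      omega
    · simp

theorem reach_checkTable (l : List (TupleSym Y)) (hl : t.z = l) :
    Reach O (checkTable good) ⟨⟨r, s, ph, ok⟩, t.fn⟩ (3 * l.length + 2)
      ⟨⟨none, s, ph, ok && l.all good⟩, ({ t with z := [] } : Tp P Q _).fn⟩ := by
  induction l generalizing t r ok with
  | nil =>
    refine (Reach.whilePop_nil hl).cast le_rfl ?_
    cases t
    simp only at hl
    simp [hl]
  | cons a l ih =>
    refine Reach.cast (Reach.whilePop_cons hl (Tp.update_z _ _) (Reach.load _ _ _) (ih rfl)) ?_ ?_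
    · simp
      omega
    · simp [Bool.and_assoc]

variable (cA) (good) (mk) (setp setq : TupleSym Y → TupleSym Y → TupleSym Y)
  (upd : Bool → TupleSym Y → TupleSym Y → Bool) (fin : TupleSym Y → TupleSym Y)
  (ans : Bool → P.Out)

/-- Test whether the tuple on `bt` lies in the relation represented by the answer of the first
oracle, starting from the element on `ba`. -/
def siftProg : TProg P Q (TupleSym Y) :=
  .seq (copyAnswer cA) <| .seq (initTable mk) <| .seq (.move (.work .z2) (.work .z) id id) <|
  .seq (passes setp setq upd fin) <| .seq (.load fun m => ⟨m.r, m.s, m.ph, true⟩) <|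
  .seq (checkTable good) <| .seq (popReg .ft) (.push .out fun m => ans (m.ok && m.s.isSome))

variable {cA good mk setp setq upd fin ans}

/-- The answer is positive only if the table passes the check and `ft` is nonempty; the tape `ft`
carries the information that the subpower is inhabited. -/
theorem reach_siftProg {w : List (Q 0).Out} {l B rest : List (TupleSym Y)}
    {ls : List (List (TupleSym Y))} (hw : t.a0 = w) (hlB : l.length = B.length) (hl : t.bt = l)
    (hB : t.ba = B ++ rest) (hps : t.ps = []) (hqs : t.qs = []) (hqs2 : t.qs2 = [])
    (hps2 : t.ps2 = []) (hz : t.z = []) (hz2 : t.z2 = [])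
    (hls : (w.map cA).reverse = blocks ls) (hel : ∀ l ∈ ls, ∀ a ∈ l, a.isEl = true)
    (hlen : ∀ l' ∈ ls, l'.length = l.length) :
    ∃ t' m', Reach O (siftProg cA mk good setp setq upd fin ans) ⟨⟨r, none, ph, false⟩, t.fn⟩
      (4 * w.length + 11 * l.length + 14 + t.kt.length *
        (ls.length * (13 * l.length + 13 + ls.length * (14 * l.length + 11)) + 6)) ⟨m', Tp.fn t'⟩ ∧
      t'.out = ans ((((fun z => ls.foldl (outerStep setp setq upd fin ls) z)^[t.kt.length]
        (List.zipWith mk l B)).all good) && t.ft.head?.isSome) :: t.out := by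
  have h1 := reach_copyAnswer (O := O) (cA := cA) (t := t) (r := r) (s := none) (ph := ph)
    (ok := false) w hw
  rw [hls, hps, hqs, List.append_nil] at h1
  have h2 := reach_initTable (O := O) (mk := mk) (r := none) (ph := ph) (ok := false)
    (t := { t with a0 := [], ps := blocks ls, qs := blocks ls }) l B hlB hl hB
  have h3 : Reach O (.move (.work .z2) (.work .z) id id) ⟨⟨none, none, ph, false⟩,
      ({ t with a0 := [], ps := blocks ls, qs := blocks ls, bt := [], ba := rest,
                z2 := (List.zipWith mk l B).reverse ++ t.z2 } : Tp P Q _).fn⟩ (3 * l.length + 2)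
      ⟨⟨none, none, ph, false⟩, ({ t with
        a0 := [], ps := blocks ls, qs := blocks ls, bt := [], ba := rest,
        z := List.zipWith mk l B } : Tp P Q _).fn⟩ :=
    Reach.cast (Reach.move (by simp) _) (by simp [hz2, hlB]) (by simp [hz2, hz])
  have h4 := reach_passes (O := O) (setp := setp) (setq := setq) (upd := upd) (fin := fin)
    (r := none) (ph := ph) (k := l.length) (t := { t with
        a0 := [], ps := blocks ls, qs := blocks ls, bt := [], ba := rest,
        z := List.zipWith mk l B }) ls t.kt (by simp [hlB]) rfl hel hlen rfl rfl hqs2 hz2 hps2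
  have hzlen := length_passes (setp := setp) (setq := setq) (upd := upd) (fin := fin) (ls := ls)
    (z := List.zipWith mk l B) (by simpa [← hlB] using hlen) t.kt.length
  simp only at h4
  generalize (fun z => ls.foldl (outerStep setp setq upd fin ls) z)^[t.kt.length]
    (List.zipWith mk l B) = z at h4 hzlen ⊢
  have h5 := Reach.load (O := O) (fun m : Mem (TupleSym Y) => ⟨m.r, m.s, m.ph, true⟩)
    ⟨none, none, ph, false⟩ ({ t with
      a0 := [], ps := blocks ls, qs := blocks ls, bt := [], ba := rest, kt := [], z := z } :
      Tp P Q _).fn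
  have h6 := reach_checkTable (O := O) (good := good) (r := none) (s := none) (ph := ph)
    (ok := true) (t := { t with
      a0 := [], ps := blocks ls, qs := blocks ls, bt := [], ba := rest, kt := [], z := z }) z rfl
  have h7 := Reach.eval (O := O) (c := (.seq (popReg .ft)
    (.push .out fun m => ans (m.ok && m.s.isSome)) : TProg P Q (TupleSym Y))) ⟨trivial, trivial⟩
    ⟨⟨none, none, ph, true && z.all good⟩, ({ t with
      a0 := [], ps := blocks ls, qs := blocks ls, bt := [], ba := rest, kt := [], z := [] } :
      Tp P Q _).fn⟩
  refine ⟨{ t with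
      a0 := [], ps := blocks ls, qs := blocks ls, bt := [], ba := rest, kt := [], z := [],
      ft := t.ft.tail, out := ans (z.all good && t.ft.head?.isSome) :: t.out },
    ⟨none, t.ft.head?, ph, z.all good⟩,
    (h1.seq (h2.seq (h3.seq (h4.seq (h5.seq (h6.seq h7)))))).cast ?_ ?_, rfl⟩
  · simp [Prog.cost, hzlen, hlB]
    omega
  · simp [Prog.eval]

end Programs

/-! ### Encodings of tuples and their lengths -/

section Words

variable {X Y : Type} {k : ℕ}

/-- A tuple written on a tape from the last entry to the first. -/
def row (f : Fin k → Y) : List (TupleSym Y) := (List.ofFn fun j => TupleSym.el (f j)).reverse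

theorem isEl_of_mem_row {f : Fin k → Y} {a : TupleSym Y} (ha : a ∈ row f) : a.isEl = true := by
  simp only [row, List.mem_reverse, List.mem_ofFn] at ha
  obtain ⟨j, rfl⟩ := ha
  rfl

@[simp] theorem length_row (f : Fin k → Y) : (row f).length = k := by simp [row]

theorem zipWith_ofFn {α β γ : Type*} (g : α → β → γ) (f : Fin k → α) (f' : Fin k → β) :
    List.zipWith g (List.ofFn f) (List.ofFn f') = List.ofFn fun j => g (f j) (f' j) := by
  apply List.ext_getElem <;> simp

theorem zipWith_row {γ : Type*} (g : TupleSym X → TupleSym Y → γ) (f : Fin k → X)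
    (f' : Fin k → Y) : List.zipWith g (row f) (row f') =
      (List.ofFn fun j => g (.el (f j)) (.el (f' j))).reverse := by
  rw [row, row, ← zipWith_ofFn, List.reverse_zipWith (by simp)]

theorem encTuples_cons (a : Fin k → X) (S : List (Fin k → X)) :
    encTuples (a :: S) = .sep :: ((List.ofFn fun j => TupleSym.el (a j)) ++ encTuples S) := rfl

theorem encTuples_append (S S' : List (Fin k → X)) :
    encTuples (S ++ S') = encTuples S ++ encTuples S' := by
  simp [encTuples]

theorem map_encTuples (h : X → Y) (S : List (Fin k → X)) :
    (encTuples S).map (TupleSym.map h) = encTuples (S.map fun a => h ∘ a) := by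
  induction S with
  | nil => rfl
  | cons a S ih =>
    rw [List.map_cons, encTuples_cons, encTuples_cons, ← ih]
    simp [TupleSym.map, List.map_ofFn, Function.comp_def]

theorem reverse_encTuples (S : List (Fin k → X)) :
    (encTuples S).reverse = blocks (S.reverse.map row) := by
  induction S with
  | nil => rfl
  | cons a S ih =>
    rw [encTuples_cons, List.reverse_cons, List.reverse_append, ih]
    simp [blocks, row]

theorem length_encTuples (S : List (Fin k → X)) : (encTuples S).length = S.length * (k + 1) := by
  rw [← List.length_reverse, reverse_encTuples, length_blocks (k := k) (by simp)]
  simp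

theorem length_enc (S : List (Fin k → X)) :
    (TupleList.enc ⟨k, S⟩).length = k + S.length * (k + 1) := by
  simp [TupleList.enc, length_encTuples]

theorem map_enc (h : X → Y) (S : List (Fin k → X)) :
    (TupleList.enc ⟨k, S⟩).map (TupleSym.map h) =
      TupleList.enc ⟨k, S.map fun a => h ∘ a⟩ := by
  simp [TupleList.enc, map_encTuples, TupleSym.map]

theorem filter_isUnit_enc (S : List (Fin k → X)) :
    (TupleList.enc ⟨k, S⟩).filter TupleSym.isUnit = List.replicate k .unit := by
  have h : (encTuples S).filter TupleSym.isUnit = [] := by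
    induction S with
    | nil => rfl
    | cons a S ih =>
      rw [encTuples_cons]
      simp [ih, TupleSym.isUnit]
  simp [TupleList.enc, h]

theorem filter_isSep_enc (S : List (Fin k → X)) :
    (TupleList.enc ⟨k, S⟩).filter TupleSym.isSep = [] ↔ S = [] := by
  cases S with
  | nil => simp [TupleList.enc, encTuples]
  | cons a S => simp [TupleList.enc, encTuples_cons]

/-- The last tuple, or the constant tuple `c` if there is none. -/
def lastTuple (c : X) (S : List (Fin k → X)) : Fin k → X := S.getLast?.getD fun _ => c

/-- The `k` unary symbols leave `k` copies of `c` at the bottom of the tape and the tuples pile up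
above them. So the top `k` letters are the last tuple or, without tuples, the constant tuple `c`. -/
theorem filterMap_entry_enc (c : X) (S : List (Fin k → X)) :
    ∃ rest, (TupleList.enc ⟨k, S⟩).reverse.filterMap (TupleSym.entry c) =
      row (lastTuple c S) ++ rest := by
  have hrow (f : Fin k → X) : (row f).filterMap (TupleSym.entry c) = row f := by
    have : row f = (List.ofFn f).reverse.map TupleSym.el := by
      simp [row, List.map_reverse, List.map_ofFn, Function.comp_def]
    rw [this, List.filterMap_map]
    exact congrFun List.filterMap_eq_map _
  have hrep (n : ℕ) : (List.replicate n (TupleSym.unit : TupleSym X)).filterMap (TupleSym.entry c) =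
      List.replicate n (.el c) := by
    induction n with
    | zero => rfl
    | succ n ih => rw [List.replicate_succ, List.filterMap_cons, ih]; rfl
  rcases List.eq_nil_or_concat S with rfl | ⟨S, a, rfl⟩
  · refine ⟨[], ?_⟩
    simp [TupleList.enc, encTuples, lastTuple, row, hrep]
  · refine ⟨(TupleList.enc ⟨k, S⟩).reverse.filterMap (TupleSym.entry c), ?_⟩
    simp only [TupleList.enc, List.concat_eq_append, encTuples_append, List.reverse_append,
      List.filterMap_append, lastTuple, List.getLast?_append]
    rw [reverse_encTuples (S := [a])]
    simp [blocks, hrow, TupleSym.entry]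

/-- A signature has at most `k |X|^2` elements; this is what keeps oracle answers polynomially long.
-/
theorem IsCompactRep.length_le [Finite X] {S : List (Fin k → X)} {W : Set (Fin k → X)}
    (hS : S.Nodup) (h : IsCompactRep {a | a ∈ S} W) : S.length ≤ 2 * (k * (Nat.card X) ^ 2) := by
  classical
  have h1 : ({a | a ∈ S} : Set (Fin k → X)).ncard = S.length := by
    rw [← List.toFinset_card_of_nodup hS, ← Set.ncard_coe_finset]
    simp
  have h2 : (Sig W).ncard ≤ k * (Nat.card X) ^ 2 := by
    refine (Set.ncard_le_ncard (Set.subset_univ _)).trans ?_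
    rw [Set.ncard_univ, Nat.card_prod, Nat.card_prod, Nat.card_fin, sq]
  rw [← h1]
  exact h.2.2.trans (Nat.mul_le_mul_left 2 h2)

end Words

/-! ### A common work alphabet -/

section Cells

/-- Pairs whose second component may be missing. -/
abbrev Ent (L U : Type) := L × Option U

/-- The entries of the work tapes. -/
abbrev Cell (L U : Type) := Ent L U × Ent L U × Ent L U × Ent L U

variable {L U : Type} {k : ℕ}

def ent (a : L × U) : Ent L U := (a.1, some a.2)

def diag {E : Type} (e : E) : E × E × E × E := (e, e, e, e)

theorem ent_injective : Function.Injective (ent : L × U → Ent L U) := fun a b h => by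
  simpa [ent, Prod.ext_iff] using h

/-- The letter for a pair, a dummy letter if the second component is missing. -/
def Ent.pair : Ent L U → TupleSym (L × U)
  | (l, some u) => .el (l, u)
  | _ => .unit

/-- The letter for the second component, a dummy letter if it is missing. -/
def Ent.second : Ent L U → TupleSym U
  | (_, some u) => .el u
  | _ => .unit

def pairLetter : TupleSym (Cell L U) → TupleSym (L × U)
  | .el y => Ent.pair y.1
  | .sep => .sep
  | .unit => .unit

def secondLetter : TupleSym (Cell L U) → TupleSym U
  | .el y => Ent.second y.1
  | .sep => .sep
  | .unit => .unit

def addLetter [Add L] : TupleSym (Cell L U) → TupleSym (Cell L U) → TupleSym (L × U)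
  | .el y, .el z => Ent.pair (z.1.1 + y.1.1, z.1.2)
  | _, _ => .unit

def pairCell (a : L × U) : Cell L U := diag (ent a)

def firstCell (l : L) : Cell L U := diag (l, none)

theorem pairLetter_map (a : TupleSym (L × U)) : pairLetter (a.map pairCell) = a := by
  cases a <;> rfl

theorem secondLetter_map (a : TupleSym (L × U)) : secondLetter (a.map pairCell) = a.map Prod.snd := by
  cases a <;> rfl

variable [Add L] (b : Fin k → L × U)

theorem flatMap_shift (ds : List (Fin k → L)) :
    (ds.flatMap fun d => pairLetter (.sep : TupleSym (Cell L U)) :: (List.zipWith addLetter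
      (row (firstCell ∘ d)) (row (pairCell ∘ b))).reverse) =
      encTuples (ds.map fun d j => ((b j).1 + d j, (b j).2)) := by
  induction ds with
  | nil => rfl
  | cons d ds ih =>
    rw [List.flatMap_cons, ih, List.map_cons, encTuples_cons, zipWith_row]
    simp [pairLetter, addLetter, firstCell, pairCell, ent, diag, Ent.pair]

end Cells

/-! ### Computing a compact representation on the machine -/

section Query

variable {F : FirstOrder.Language.{v, w}} [F.IsAlgebraic] {R : Type*} [Ring R] {L U : Type}
  [AddCommGroup L] [Module R L] [Finite L] [Finite U] {SL : F.Structure L} {SU : F.Structure U}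
  {T : ∀ n, F.Functions n → (Fin n → U) → L}

variable (SL SU T) in
/-- The two oracles. -/
abbrev oracles : Fin 2 → SearchProblem :=
  ![CompRep (prodAlg SL SU), CompRepClonoid (Diff0 SL SU T)]

/-- `c` is the value of a closed term, if there is one. -/
def IsConstant (S : F.Structure (L × U)) (c : Ent L U) : Prop :=
  ∀ _ : F.Term (Fin 0), ∃ (t : F.Term (Fin 0)), ent (termOp S t Fin.elim0) = c

omit [F.IsAlgebraic] [Finite L] [Finite U] in
theorem exists_isConstant (S : F.Structure (L × U)) : ∃ c, IsConstant S c := by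
  rcases isEmpty_or_nonempty (F.Term (Fin 0)) with h | ⟨⟨t⟩⟩
  · exact ⟨(0, none), fun t => h.elim t⟩
  · exact ⟨_, fun _ => ⟨t, rfl⟩⟩

omit [AddCommGroup L] [Finite L] [Finite U] in
theorem IsConstant.lastTuple {S : F.Structure (L × U)} {c : Ent L U} (hc : IsConstant S c) {k : ℕ}
    {as : List (Fin k → L × U)} (h : Nonempty (F.Term (Fin as.length))) :
    ∃ b ∈ Sg S as, _root_.lastTuple (diag c) (as.map fun a => pairCell ∘ a) = pairCell ∘ b := by
  rcases List.eq_nil_or_concat as with rfl | ⟨as, a, rfl⟩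
  · obtain ⟨t, ht⟩ := hc h.some
    refine ⟨fun _ => termOp S t Fin.elim0, (mem_Sg_iff _ _ _).2 ⟨t, fun j => ?_⟩, ?_⟩
    · congr 1
      funext i
      exact i.elim0
    · simp [_root_.lastTuple, ← ht]
      rfl
  · exact ⟨a, subset_Sg _ (by simp), by simp [_root_.lastTuple]⟩

omit [AddCommGroup L] [Finite L] [Finite U] in
theorem Sg_eq_empty {S : F.Structure (L × U)} {k : ℕ} {as : List (Fin k → L × U)}
    (h : IsEmpty (F.Term (Fin as.length))) : Sg S as = ∅ := by
  refine Set.eq_empty_of_forall_notMem fun y hy => ?_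
  obtain ⟨t, -⟩ := (mem_Sg_iff _ _ _).1 hy
  exact h.elim t

open scoped Classical

variable {P : SearchProblem} {t : Tp P (oracles SL SU T) (TupleSym (Cell L U))}
  {r : Option (TupleSym (Cell L U))} {ph : Fin 3} {ok : Bool}
  {O : ∀ i : Fin 2, List (oracles SL SU T i).In → List (oracles SL SU T i).Out}

/-- The program computing a compact representation of a subpower of the wreath product on the
answer tape of the first oracle. -/
def queryProg (P : SearchProblem) (SL : F.Structure L) (SU : F.Structure U)
    (T : ∀ n, F.Functions n → (Fin n → U) → L) :
    TProg P (oracles SL SU T) (TupleSym (Cell L U)) :=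
  translateProg (secondLetter : _ → TupleSym U) (fun a : TupleSym L => a.map firstCell)
    (addLetter : _ → _ → TupleSym (L × U)) (pairLetter : _ → TupleSym (L × U))

theorem reach_queryProg (hL : IsAffine R SL)
    (hL0 : ∀ n (f : F.Functions n), SL.funMap f (fun _ => 0) = 0)
    (hA : IsMaltsev (wreathAlg SL SU T))
    (hClo : ∀ n, Clo (prodAlg SL SU) n ⊆ Clo (wreathAlg SL SU T) n)
    (hO : ∀ i, (oracles SL SU T i).Solves (O i)) {c : Ent L U}
    (hc : IsConstant (prodAlg SL SU) c)
    {k : ℕ} {as : List (Fin k → L × U)}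
    (hc1 : t.c1 = ((TupleList.enc ⟨k, as⟩).map (TupleSym.map pairCell)).reverse)
    (hc2 : t.c2 = ((TupleList.enc ⟨k, as⟩).map (TupleSym.map pairCell)).reverse)
    {rest : List (TupleSym (Cell L U))}
    (hba : t.ba = row (lastTuple (diag c) (as.map fun a => pairCell ∘ a)) ++ rest)
    (hq0 : t.q0 = []) (hq1 : t.q1 = []) (hds : t.ds = []) (hst : t.st = []) :
    ∃ S : List (Fin k → L × U), S.Nodup ∧
      IsCompactRep {a | a ∈ S} (Sg (wreathAlg SL SU T) as) ∧
      Reach O (queryProg P SL SU T) ⟨⟨r, none, ph, ok⟩, t.fn⟩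
        (6 * (TupleList.enc ⟨k, as⟩).length +
          2 * (k * Nat.card L ^ 2) * (13 * k + 9) + 10)
        ⟨⟨none, none, ph, ok⟩, ({ t with
          c1 := []
          c2 := []
          a1 := []
          a0 := encTuples S } : Tp P _ _).fn⟩ := by
  set us : List (Fin k → U) := as.map fun a j => (a j).2 with hus
  obtain ⟨D, hDnd, hD, hOD⟩ : ∃ D : List (Fin k → L), D.Nodup ∧
      IsCompactRep {d | d ∈ D} (clonoidImage (Diff0 SL SU T) us) ∧
      O 1 (TupleList.enc ⟨k, us⟩) = encTuples D :=
    hO 1 (⟨k, us⟩ : TupleList U)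
  have hDlen := hD.length_le hDnd
  set w := TupleList.enc ⟨k, as⟩ with hw
  set wr := (w.map (TupleSym.map pairCell)).reverse with hwr
  have e1 : (wr.map (secondLetter : _ → TupleSym U)).reverse =
      TupleList.enc ⟨k, us⟩ := by
    rw [hwr, List.map_reverse, List.reverse_reverse, List.map_map,
      show (secondLetter ∘ TupleSym.map pairCell : TupleSym (L × U) → TupleSym U) =
        TupleSym.map Prod.snd from funext secondLetter_map, hw, map_enc]
    rfl
  have e2 : wr.map (pairLetter : _ → TupleSym (L × U)) = w.reverse := by
    rw [hwr, List.map_reverse, List.map_map,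
      show (pairLetter ∘ TupleSym.map pairCell : TupleSym (L × U) → TupleSym (L × U)) = id from
        funext pairLetter_map, List.map_id]
  set ls : List (List (TupleSym (Cell L U))) := D.reverse.map fun d => row (firstCell ∘ d) with hls
  have h1 : ((O 1 (wr.map (secondLetter : _ → TupleSym U)).reverse).map
      (fun a : TupleSym L => (a.map firstCell : TupleSym (Cell L U)))).reverse = blocks ls := by
    rw [e1, hOD, hls]
    refine (congrArg List.reverse (map_encTuples firstCell D)).trans ?_
    rw [reverse_encTuples, ← List.map_reverse, List.map_map]
    rfl
  have hlsl : ∀ l ∈ ls, l.length = k := by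
    intro l hl
    obtain ⟨d, -, rfl⟩ := List.mem_map.1 hl
    exact length_row _
  have key := reach_translate (O := O) (r := r) (ph := ph) (ok := ok)
    (addQ := (addLetter : _ → _ → TupleSym (L × U))) (toQ := (pairLetter : _ → TupleSym (L × U)))
    (toC := (secondLetter : _ → TupleSym U)) (cL := fun a : TupleSym L => a.map firstCell)
    hc1 hc2 hba hq0 hq1 hds hst h1 (fun l hl a ha => by
      obtain ⟨d, -, rfl⟩ := List.mem_map.1 hl
      exact isEl_of_mem_row ha) fun l hl => by rw [hlsl l hl, length_row]
  obtain ⟨bs, hbs, hSg⟩ : ∃ bs : List (Fin k → L × U),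
      (ls.reverse.flatMap fun l => pairLetter (.sep : TupleSym (Cell L U)) ::
        (List.zipWith addLetter l
          (row (lastTuple (diag c) (as.map fun a => pairCell ∘ a)))).reverse) = encTuples bs ∧
      Sg (wreathAlg SL SU T) as = Sg (prodAlg SL SU) (as ++ bs) := by
    rcases eq_or_ne D [] with h0 | h0
    -- With no differences the tuple on `ba` is never used; it need not belong to the subpower,
    -- which may be empty.
    · refine ⟨[], by simp [hls, h0, encTuples], ?_⟩
      rcases isEmpty_or_nonempty (Fin k → L × U) with h | ⟨⟨b⟩⟩
      · exact Set.ext fun x => h.elim x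
      · have := hL.Sg_wreathAlg hL0 hA hClo (ds := D) (b := b) (fun h => (h h0).elim) hD
        rwa [h0] at this
    · obtain ⟨d, hd⟩ := List.exists_mem_of_ne_nil _ h0
      -- An element of the clonoid image comes with a term in the generators, so the tuple on `ba`
      -- is a genuine element of the subpower: the last generator or the value of a closed term.
      obtain ⟨t, -⟩ := (hL.mem_image_Diff0 hL0).1 (hD.1 hd)
      obtain ⟨b, hb, hlast⟩ := hc.lastTuple ⟨t⟩
      have hSg := hL.Sg_wreathAlg hL0 hA hClo (as := as) (ds := D) (b := b) (fun _ => hb) hD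
      refine ⟨_, ?_, hSg⟩
      rw [hlast, ← flatMap_shift, hls, List.map_reverse, List.reverse_reverse, List.flatMap_map]
  obtain ⟨S, hSnd, hS, hOS⟩ : ∃ S : List (Fin k → L × U), S.Nodup ∧
      IsCompactRep {a | a ∈ S} (Sg (prodAlg SL SU) (as ++ bs)) ∧
      O 0 (TupleList.enc ⟨k, as ++ bs⟩) = encTuples S :=
    hO 0 (⟨k, as ++ bs⟩ : TupleList (L × U))
  refine ⟨S, hSnd, hSg ▸ hS, key.cast ?_ ?_⟩
  · have h2 : ls.length = D.length := by simp [hls]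
    have h3 : wr.length = w.length := by simp [hwr]
    -- The two summands are the costs of moving the oracle's answer and of shifting its tuples.
    have h4 : 3 * (D.length * (k + 1)) + D.length * (10 * k + 6) = D.length * (13 * k + 9) := by
      ring
    have h5 := Nat.mul_le_mul_right (13 * k + 9) hDlen
    rw [length_blocks hlsl, length_row, h2, h3]
    omega
  · have e3 : (wr.map (pairLetter : _ → TupleSym (L × U))).reverse ++
        (ls.reverse.flatMap fun l => pairLetter (.sep : TupleSym (Cell L U)) ::
          (List.zipWith addLetter l
            (row (lastTuple (diag c) (as.map fun a => pairCell ∘ a)))).reverse) =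
        TupleList.enc ⟨k, as ++ bs⟩ := by
      rw [hbs, e2, List.reverse_reverse]
      simp [hw, TupleList.enc, encTuples_append]
    exact congrArg (fun a0 => (⟨(⟨none, none, ph, ok⟩ : Mem (TupleSym (Cell L U))),
      ({ t with c1 := [], c2 := [], a1 := [], a0 := a0 } : Tp P (oracles SL SU T) _).fn⟩ :
        Config (Tape.Letter P (oracles SL SU T) (TupleSym (Cell L U))) (Mem (TupleSym (Cell L U)))))
      ((congrArg (O 0) e3).trans hOS)

end Query

/-! ### Sifting in terms of table letters -/

section SiftLetters

variable {E : Type} {k : ℕ}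

open scoped Classical

def setFirst : TupleSym (E × E × E × E) → TupleSym (E × E × E × E) → TupleSym (E × E × E × E)
  | .el y, .el z => .el (y.1, z.2)
  | _, _ => .unit

def setSecond : TupleSym (E × E × E × E) → TupleSym (E × E × E × E) → TupleSym (E × E × E × E)
  | .el y, .el z => .el (z.1, y.1, z.2.2)
  | _, _ => .unit

/-- Update the information whether two tuples fork properly when a new entry becomes known. -/
noncomputable def forkUpdate (ok : Bool) : TupleSym (E × E × E × E) → TupleSym (E × E × E × E) → Bool
  | .el y, .el z => if z.1 ≠ y.1 then decide (z.1 = z.2.2.1 ∧ y.1 = z.2.2.2) else ok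
  | _, _ => ok

def applyThird (μ : E → E → E → E) : TupleSym (E × E × E × E) → TupleSym (E × E × E × E)
  | .el (p, q, x, b) => .el (p, q, μ p q x, b)
  | a => a

def startEntry : TupleSym (E × E × E × E) → TupleSym (E × E × E × E) → TupleSym (E × E × E × E)
  | .el y, .el z => .el (z.1, z.1, z.1, y.1)
  | _, _ => .unit

noncomputable def sameEntry : TupleSym (E × E × E × E) → Bool
  | .el (_, _, x, b) => decide (x = b)
  | _ => true

/-- The table for the tuples `p`, `q`, `x` and `b`. -/
def table (p q x b : Fin k → E) : List (TupleSym (E × E × E × E)) :=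
  row fun j => (p j, q j, x j, b j)

theorem zipWith_setFirst (f p q x b : Fin k → E) :
    List.zipWith setFirst (row (diag ∘ f)) (table p q x b) = table f q x b :=
  zipWith_row _ _ _

theorem zipWith_setSecond (f p q x b : Fin k → E) :
    List.zipWith setSecond (row (diag ∘ f)) (table p q x b) = table p f x b :=
  zipWith_row _ _ _

theorem zipWith_startEntry (x b : Fin k → E) :
    List.zipWith startEntry (row (diag ∘ b)) (row (diag ∘ x)) = table x x x b :=
  zipWith_row _ _ _

theorem map_applyThird (μ : E → E → E → E) (p q x b : Fin k → E) :
    (table p q x b).map (applyThird μ) = table p q (fun j => μ (p j) (q j) (x j)) b := by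
  simp [table, row, List.map_reverse, List.map_ofFn, Function.comp_def, applyThird]

theorem all_sameEntry (p q x b : Fin k → E) :
    (table p q x b).all sameEntry = true ↔ x = b := by
  simp [table, row, sameEntry, funext_iff, List.mem_ofFn]

theorem flag_forkUpdate (f p q x b : Fin k → E) :
    flag forkUpdate (row (diag ∘ f)) (table p q x b) false = true ↔ ForkAt b p f x := by
  have h : (row (diag ∘ f)).zip (table p q x b) = (List.ofFn fun j =>
      (TupleSym.el (diag (f j)), TupleSym.el (p j, q j, x j, b j))).reverse :=
    zipWith_row _ _ _
  -- Rows are stored from the last entry to the first, so coordinate `0` is processed last. Every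
  -- difference overrides the flag, and its final value is decided by the first coordinate where the
  -- tuples differ.
  rw [flag, h, List.foldl_reverse]
  clear h
  induction k with
  | zero => simp [ForkAt]
  | succ k ih =>
    rw [List.ofFn_succ, List.foldr_cons]
    have hih := ih (fun j => f j.succ) (fun j => p j.succ) (fun j => q j.succ) (fun j => x j.succ)
      (fun j => b j.succ)
    by_cases h0 : p 0 = f 0
    · rw [show ∀ ok, forkUpdate ok (.el (diag (f 0))) (.el (p 0, q 0, x 0, b 0)) = ok from
        fun ok => if_neg (not_not.2 h0)]
      refine hih.trans ?_
      rw [ForkAt, ForkAt, Fin.exists_fin_succ]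
      simp [h0, Fin.forall_fin_succ]
    · rw [show ∀ ok, forkUpdate ok (.el (diag (f 0))) (.el (p 0, q 0, x 0, b 0)) =
        decide (p 0 = x 0 ∧ f 0 = b 0) from fun ok => if_pos h0, decide_eq_true_iff]
      refine ⟨fun h => ⟨0, fun j hj => absurd hj (Fin.not_lt_zero j), h0, h⟩, ?_⟩
      rintro ⟨i, hi, -, h⟩
      rcases Fin.eq_zero_or_eq_succ i with rfl | ⟨i, rfl⟩
      · exact h
      · exact absurd (hi 0 (Fin.succ_pos i)) h0

variable (μ : E → E → E → E)

theorem innerStep_table (f p q x b : Fin k → E) :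
    innerStep setSecond forkUpdate (applyThird μ) (table p q x b) (row (diag ∘ f)) =
      table p f (siftStep μ b p x f) b := by
  unfold innerStep siftStep
  rw [zipWith_setSecond, map_applyThird]
  simp only [flag_forkUpdate]
  split_ifs <;> rfl

/-- Only the components `x` and `b` of the table matter; what remains of the second tuple is
overwritten later and is left existential. -/
theorem outerStep_table (S : List (Fin k → E)) (f p q x b : Fin k → E) :
    ∃ q', outerStep setFirst setSecond forkUpdate (applyThird μ)
      (S.map fun a => row (diag ∘ a)) (table p q x b) (row (diag ∘ f)) =
        table f q' (S.foldl (siftStep μ b f) x) b := by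
  rw [outerStep, zipWith_setFirst]
  induction S generalizing q x with
  | nil => exact ⟨q, rfl⟩
  | cons a S ih =>
    rw [List.map_cons, List.foldl_cons, innerStep_table]
    exact ih _ _

theorem pass_table (S : List (Fin k → E)) (p q x b : Fin k → E) :
    ∃ p' q', (S.map fun a => row (diag ∘ a)).foldl (outerStep setFirst setSecond forkUpdate
      (applyThird μ) (S.map fun a => row (diag ∘ a))) (table p q x b) =
        table p' q' (siftPass μ b S x) b := by
  have key : ∀ (S' : List (Fin k → E)) (p q x : Fin k → E), ∃ p' q',
      (S'.map fun a => row (diag ∘ a)).foldl (outerStep setFirst setSecond forkUpdate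
      (applyThird μ) (S.map fun a => row (diag ∘ a))) (table p q x b) =
        table p' q' (S'.foldl (fun x p => S.foldl (siftStep μ b p) x) x) b := by
    intro S'
    induction S' with
    | nil => exact fun p q x => ⟨p, q, rfl⟩
    | cons a S' ih =>
      intro p q x
      obtain ⟨q', h⟩ := outerStep_table μ S a p q x b
      rw [List.map_cons, List.foldl_cons, h]
      exact ih _ _ _
  exact key S p q x

theorem passes_table (S : List (Fin k → E)) (x b : Fin k → E) (n : ℕ) :
    ∃ p q, (fun z => (S.map fun a => row (diag ∘ a)).foldl (outerStep setFirst setSecond forkUpdate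
      (applyThird μ) (S.map fun a => row (diag ∘ a))) z)^[n]
      (List.zipWith startEntry (row (diag ∘ b)) (row (diag ∘ x))) =
        table p q ((siftPass μ b S)^[n] x) b := by
  induction n with
  | zero => exact ⟨x, x, zipWith_startEntry x b⟩
  | succ n ih =>
    obtain ⟨p, q, h⟩ := ih
    obtain ⟨p', q', h'⟩ := pass_table μ S p q ((siftPass μ b S)^[n] x) b
    refine ⟨p', q', ?_⟩
    rw [Function.iterate_succ_apply', h, Function.iterate_succ_apply', ← h']

end SiftLetters

/-! ### Transport of sifting along an injective encoding -/

section SiftMap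

variable {A E : Type} {k : ℕ} {e : A → E} {ν : E → E → E → E} {μ : A → A → A → A}

/-- The fork test uses only equalities of entries, which injectivity of `e` reflects. Thus it does
not matter how the Mal'tsev operation is extended to entries with a missing component. -/
theorem siftStep_comp (he : e.Injective) (h : ∀ p q x, ν (e p) (e q) (e x) = e (μ p q x))
    (b p x q : Fin k → A) :
    siftStep ν (e ∘ b) (e ∘ p) (e ∘ x) (e ∘ q) = e ∘ siftStep μ b p x q := by
  have : ForkAt (e ∘ b) (e ∘ p) (e ∘ q) (e ∘ x) ↔ ForkAt b p q x := by
    simp [ForkAt, he.eq_iff]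
  unfold siftStep
  by_cases hf : ForkAt b p q x
  · rw [if_pos hf, if_pos (this.2 hf)]
    exact funext fun j => h _ _ _
  · rw [if_neg hf, if_neg (this.not.2 hf)]

theorem siftPass_comp (he : e.Injective) (h : ∀ p q x, ν (e p) (e q) (e x) = e (μ p q x))
    (b : Fin k → A) (S : List (Fin k → A)) (x : Fin k → A) :
    siftPass ν (e ∘ b) (S.map fun a => e ∘ a) (e ∘ x) = e ∘ siftPass μ b S x := by
  have h1 (p x : Fin k → A) (S : List (Fin k → A)) :
      (S.map fun a => e ∘ a).foldl (siftStep ν (e ∘ b) (e ∘ p)) (e ∘ x) =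
        e ∘ S.foldl (siftStep μ b p) x := by
    induction S generalizing x with
    | nil => rfl
    | cons a S ih => rw [List.map_cons, List.foldl_cons, siftStep_comp he h, ih, List.foldl_cons]
  unfold siftPass
  generalize S = S' at h1 ⊢
  suffices ∀ S : List (Fin k → A), (S.map fun a => e ∘ a).foldl
      (fun x p => (S'.map fun a => e ∘ a).foldl (siftStep ν (e ∘ b) p) x) (e ∘ x) =
      e ∘ S.foldl (fun x p => S'.foldl (siftStep μ b p) x) x from this S'
  intro S
  induction S generalizing x with
  | nil => rfl
  | cons a S ih => rw [List.map_cons, List.foldl_cons, h1, ih, List.foldl_cons]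

theorem all_passes (he : e.Injective) (h : ∀ p q x, ν (e p) (e q) (e x) = e (μ p q x))
    (b : Fin k → A) (S : List (Fin k → A)) (x : Fin k → A) (n : ℕ) :
    ((fun z => (S.map fun a => row (diag ∘ e ∘ a)).foldl (outerStep setFirst setSecond forkUpdate
      (applyThird ν) (S.map fun a => row (diag ∘ e ∘ a))) z)^[n]
      (List.zipWith startEntry (row (diag ∘ e ∘ b)) (row (diag ∘ e ∘ x)))).all sameEntry = true ↔
        (siftPass μ b S)^[n] x = b := by
  obtain ⟨p, q, hpq⟩ := passes_table ν (S.map fun a => e ∘ a) (e ∘ x) (e ∘ b) n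
  rw [List.map_map] at hpq
  have h2 : ∀ n, (siftPass ν (e ∘ b) (S.map fun a => e ∘ a))^[n] (e ∘ x) =
      e ∘ (siftPass μ b S)^[n] x := by
    intro n
    induction n with
    | zero => rfl
    | succ n ih =>
      rw [Function.iterate_succ_apply', ih, siftPass_comp he h, Function.iterate_succ_apply']
  refine (Iff.of_eq (congrArg (fun z => List.all z sameEntry = true) hpq)).trans ?_
  rw [all_sameEntry, h2]
  exact he.comp_left.eq_iff

end SiftMap

/-! ### Assembling the two programs -/

section Reductions

/-- The tapes of an initial configuration. -/
def Tp.start {P : SearchProblem} {Q : Fin 2 → SearchProblem} {Γ : Type} (x : List P.In) :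
    Tp P Q Γ :=
  ⟨x, [], [], [], [], [], [], [], [], [], [], [], [], [], [], [], [], [], [], []⟩

theorem config_start {P : SearchProblem} {Q : Fin 2 → SearchProblem} {Γ : Type} (m : Mem Γ)
    (x : List P.In) : (Config.start m x : Config (Tape.Letter P Q Γ (κ := WT)) (Mem Γ)) =
      ⟨m, (Tp.start x).fn⟩ := by
  refine congrArg (Config.mk m) (funext fun k => ?_)
  rcases k with _ | _ | i | i | (_ | _)
  all_goals first | rfl | (fin_cases i <;> rfl)

theorem reach_copyOut {P : SearchProblem} {Q : Fin 2 → SearchProblem} {Y : Type}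
    {O : ∀ i : Fin 2, List (Q i).In → List (Q i).Out} {t : Tp P Q (TupleSym Y)}
    {m : Mem (TupleSym Y)} {cA : (Q 0).Out → TupleSym Y} (g : TupleSym Y → P.Out)
    (w : List (Q 0).Out) (hw : t.a0 = w) (hds : t.ds = []) (hout : t.out = []) :
    ∃ s, Reach O (.seq (.move (.ans 0) (.work .ds) cA id) (.move (.work .ds) .out id g) :
      TProg P Q (TupleSym Y)) ⟨m, t.fn⟩ (6 * w.length + 4) s ∧
        s.tape .out = w.map fun a => g (cA a) := by
  refine ⟨_, (Reach.seq (Reach.move (by simp) _) (Reach.move (by simp) _)).mono ?_, ?_⟩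
  · simp [hw, hds]
    omega
  · simp [hw, hds, hout]

variable {F : FirstOrder.Language.{v, w}} [F.IsAlgebraic] {R : Type*} [Ring R] {L U : Type}
  [AddCommGroup L] [Module R L] [Finite L] [Finite U] {SL : F.Structure L} {SU : F.Structure U}
  {T : ∀ n, F.Functions n → (Fin n → U) → L}

variable (SL SU T) in
/-- The program for compact representations of subpowers of the wreath product. -/
def compRepProg (c : Ent L U) :
    TProg (CompRep (wreathAlg SL SU T)) (oracles SL SU T) (TupleSym (Cell L U)) :=
  .seq (.whilePop .inp (fun a : TupleSym (L × U) => a.map pairCell) (readBody (diag c))) <|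
  .seq (queryProg _ SL SU T) <|
  .seq (.move (.ans 0) (.work .ds) (fun a : TupleSym (L × U) => a.map pairCell) id)
    (.move (.work .ds) .out id (pairLetter : _ → TupleSym (L × U)))

theorem reach_compRepProg (hL : IsAffine R SL)
    (hL0 : ∀ n (f : F.Functions n), SL.funMap f (fun _ => 0) = 0)
    (hA : IsMaltsev (wreathAlg SL SU T))
    (hClo : ∀ n, Clo (prodAlg SL SU) n ⊆ Clo (wreathAlg SL SU T) n)
    {O : ∀ i : Fin 2, List (oracles SL SU T i).In → List (oracles SL SU T i).Out}
    (hO : ∀ i, (oracles SL SU T i).Solves (O i)) {c : Ent L U}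
    (hc : IsConstant (prodAlg SL SU) c) (x : TupleList (L × U)) :
    ∃ s, Reach O (compRepProg SL SU T c) (Config.start ⟨none, none, 2, false⟩ x.enc)
      (15 * x.enc.length + 2 * (x.k * Nat.card L ^ 2) * (13 * x.k + 9) +
        6 * (2 * (x.k * Nat.card (L × U) ^ 2) * (x.k + 1)) + 16) s ∧
      (CompRep (wreathAlg SL SU T)).Sol x (s.tape .out) := by
  obtain ⟨k, as⟩ := x
  obtain ⟨rest, hrest⟩ := filterMap_entry_enc (diag c) (as.map fun a => pairCell ∘ a)
  have h1 := reach_read_two (P := CompRep (wreathAlg SL SU T)) (O := O) (r := none) (s := none)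
    (ok := false) (t := Tp.start (TupleList.enc ⟨k, as⟩)) (c := diag c)
    (conv := fun a : TupleSym (L × U) => a.map pairCell) _ rfl
  obtain ⟨S, hSnd, hS, h2⟩ := reach_queryProg (P := CompRep (wreathAlg SL SU T)) (O := O)
    (r := none) (ph := 2) (ok := false) hL hL0 hA hClo hO hc (k := k) (as := as)
    (t := ({ Tp.start (TupleList.enc ⟨k, as⟩) with inp := [] } : Tp _ _ _).read (diag c)
      ((TupleList.enc ⟨k, as⟩).map (TupleSym.map pairCell)))
    (List.append_nil _) (List.append_nil _) (rest := rest)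
    (by rw [← hrest, ← map_enc]; exact List.append_nil _) rfl rfl rfl rfl
  have hSlen := Nat.mul_le_mul_right (k + 1) (hS.length_le hSnd)
  obtain ⟨s, h3, h4⟩ := reach_copyOut (P := CompRep (wreathAlg SL SU T)) (O := O) (Q := oracles SL SU T)
    (m := ⟨none, none, 2, false⟩) (cA := fun a : TupleSym (L × U) => a.map pairCell)
    (pairLetter : _ → TupleSym (L × U))
    (t := { ({ Tp.start (TupleList.enc ⟨k, as⟩) with inp := [] } : Tp _ _ _).read (diag c)
      ((TupleList.enc ⟨k, as⟩).map (TupleSym.map pairCell)) with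
      c1 := [], c2 := [], a1 := [], a0 := encTuples S })
    (encTuples S) rfl rfl rfl
  refine ⟨s, (config_start (P := CompRep (wreathAlg SL SU T)) _ _).symm ▸
    (h1.seq (h2.seq h3)).mono ?_, S, hSnd, hS, h4.trans ?_⟩
  · change 9 * (TupleList.enc ⟨k, as⟩).length + 2 + (6 * (TupleList.enc ⟨k, as⟩).length +
      2 * (k * Nat.card L ^ 2) * (13 * k + 9) + 10 + (6 * (encTuples S).length + 4)) ≤
      15 * (TupleList.enc ⟨k, as⟩).length + 2 * (k * Nat.card L ^ 2) * (13 * k + 9) +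
        6 * (2 * (k * Nat.card (L × U) ^ 2) * (k + 1)) + 16
    rw [length_encTuples]
    omega
  · exact (List.map_congr_left fun a _ => pairLetter_map a).trans (List.map_id _)

/-- A Mal'tsev operation, extended arbitrarily. -/
def Ent.maltsev (μ : L × U → L × U → L × U → L × U) : Ent L U → Ent L U → Ent L U → Ent L U
  | (p, some p'), (q, some q'), (x, some x') => ent (μ (p, p') (q, q') (x, x'))
  | _, _, x => x

open scoped Classical

variable (SL SU T) in
/-- The program for the subpower membership problem of the wreath product. -/
noncomputable def smpProg (c : Ent L U) (μ : L × U → L × U → L × U → L × U) :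
    TProg (SMP (wreathAlg SL SU T)) (oracles SL SU T) (TupleSym (Cell L U)) :=
  .seq (if Nonempty (F.Term (Fin 0)) then .push (.work .ft) (fun _ => .unit) else .load id) <|
  .seq (.whilePop .inp (fun a : TupleSym (L × U) => a.map pairCell) (readBody (diag c))) <|
  .seq (queryProg _ SL SU T) <|
  siftProg (fun a : TupleSym (L × U) => a.map pairCell) startEntry sameEntry setFirst setSecond
    forkUpdate (applyThird (Ent.maltsev μ)) id

theorem reach_sift {P : SearchProblem} {t : Tp P (oracles SL SU T) (TupleSym (Cell L U))}
    {r : Option (TupleSym (Cell L U))} {ph : Fin 3} {ans : Bool → P.Out}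
    {O : ∀ i : Fin 2, List (oracles SL SU T i).In → List (oracles SL SU T i).Out}
    (μ : L × U → L × U → L × U → L × U) {k : ℕ} (S : List (Fin k → L × U)) (b : Fin k → L × U)
    (f : Fin k → Cell L U) {rest : List (TupleSym (Cell L U))} (ha0 : t.a0 = encTuples S)
    (hbt : t.bt = row (pairCell ∘ b)) (hba : t.ba = row f ++ rest)
    (hkt : t.kt = List.replicate k .unit) (hout : t.out = []) (hps : t.ps = []) (hqs : t.qs = [])
    (hqs2 : t.qs2 = []) (hps2 : t.ps2 = []) (hz : t.z = []) (hz2 : t.z2 = []) :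
    ∃ s d, Reach O (siftProg (fun a : TupleSym (L × U) => a.map pairCell) startEntry sameEntry
        setFirst setSecond forkUpdate (applyThird (Ent.maltsev μ)) ans :
          TProg P (oracles SL SU T) (TupleSym (Cell L U))) ⟨⟨r, none, ph, false⟩, t.fn⟩
        (4 * (S.length * (k + 1)) + 11 * k + 14 +
          k * (S.length * (13 * k + 13 + S.length * (14 * k + 11)) + 6)) s ∧
      s.tape .out = [ans d] ∧ (t.ft = [] → d = false) ∧
      (t.ft ≠ [] → ∀ x, f = pairCell ∘ x →
        (d = true ↔ (siftPass μ b S.reverse)^[k] x = b)) := by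
  have hls : ((encTuples S).map (TupleSym.map pairCell)).reverse =
      blocks (S.reverse.map fun a => row (diag ∘ (ent ∘ a) : Fin k → Cell L U)) := by
    rw [map_encTuples, reverse_encTuples, ← List.map_reverse, List.map_map]
    rfl
  obtain ⟨t', m', h, hout'⟩ := reach_siftProg (O := O) (r := r) (ph := ph) (t := t) (ans := ans)
    (mk := startEntry) (good := sameEntry) (setp := setFirst) (setq := setSecond)
    (upd := forkUpdate) (fin := applyThird (Ent.maltsev μ))
    (cA := fun a : TupleSym (L × U) => a.map pairCell) (w := encTuples S) (B := row f)
    ha0 (by simp) hbt hba hps hqs hqs2 hps2 hz hz2 hls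
    (fun l hl a ha => by
      obtain ⟨g, -, rfl⟩ := List.mem_map.1 hl
      exact isEl_of_mem_row ha)
    (fun l hl => by
      obtain ⟨g, -, rfl⟩ := List.mem_map.1 hl
      rw [length_row, length_row])
  have hktl : t.kt.length = k := by rw [hkt, List.length_replicate]
  rw [hktl, hout] at hout'
  refine ⟨_, _, h.mono (Eq.le ?_), hout', fun hft => by rw [hft]; exact Bool.and_false _, ?_⟩
  · rw [hktl, length_row, List.length_map, List.length_reverse]
    exact congrArg (fun n => 4 * n + 11 * k + 14 +
      k * (S.length * (13 * k + 13 + S.length * (14 * k + 11)) + 6)) (length_encTuples S)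
  · rintro hft x rfl
    obtain ⟨a, w, hw⟩ := List.exists_cons_of_ne_nil hft
    rw [hw]
    -- The machine runs through the representation in reversed order, which is harmless because
    -- sifting works for every order of the pairs.
    refine (Iff.of_eq (congrArg (· = true) (Bool.and_true _))).trans ?_
    exact all_passes ent_injective (fun p q x => rfl) b S.reverse x k

theorem reach_smpProg (hL : IsAffine R SL)
    (hL0 : ∀ n (f : F.Functions n), SL.funMap f (fun _ => 0) = 0)
    (hA : IsMaltsev (wreathAlg SL SU T))
    (hClo : ∀ n, Clo (prodAlg SL SU) n ⊆ Clo (wreathAlg SL SU T) n)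
    {O : ∀ i : Fin 2, List (oracles SL SU T i).In → List (oracles SL SU T i).Out}
    (hO : ∀ i, (oracles SL SU T i).Solves (O i)) {c : Ent L U}
    (hc : IsConstant (prodAlg SL SU) c) {m : F.Term (Fin 3)}
    (hm : ∀ x y, termOp (wreathAlg SL SU T) m ![y, x, x] = y ∧
      termOp (wreathAlg SL SU T) m ![x, x, y] = y) {k n : ℕ} (b : Fin k → L × U)
    (as : List (Fin k → L × U)) (hn : (TupleList.enc ⟨k, b :: as⟩).length = n) :
    ∃ s, Reach O (smpProg SL SU T c fun p q x => termOp (wreathAlg SL SU T) m ![x, p, q])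
      (Config.start ⟨none, none, 0, false⟩ (TupleList.enc ⟨k, b :: as⟩))
      (15 * n + 2 * (n * Nat.card L ^ 2) * (13 * n + 9) +
        4 * (2 * (n * Nat.card (L × U) ^ 2) * (n + 1)) + 11 * n + 27 +
          n * (2 * (n * Nat.card (L × U) ^ 2) * (13 * n + 13 +
            2 * (n * Nat.card (L × U) ^ 2) * (14 * n + 11)) + 6)) s ∧
      (SMP (wreathAlg SL SU T)).Sol ⟨k, b, as⟩ (s.tape .out) := by
  have hkn : k ≤ n := by
    rw [← hn, length_enc]
    exact Nat.le_add_right _ _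
  have hasn : (TupleList.enc ⟨k, as⟩).length ≤ n := by
    rw [← hn, length_enc, length_enc, List.length_cons]
    gcongr
    exact Nat.le_succ _
  -- The existence of closed terms depends only on the language and is wired into the program.
  -- Reading adds a letter to `ft` for every generator, so in the end `ft` is empty exactly when no
  -- term in the generators exists.
  set ft₀ : List (TupleSym (Cell L U)) := if Nonempty (F.Term (Fin 0)) then [.unit] else [] with hft₀
  set t₀ : Tp (SMP (wreathAlg SL SU T)) (oracles SL SU T) (TupleSym (Cell L U)) :=
    { Tp.start (TupleList.enc ⟨k, b :: as⟩) with ft := ft₀ } with ht₀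
  have h0 : Reach O (if Nonempty (F.Term (Fin 0)) then .push (.work .ft) (fun _ => .unit)
      else .load id : TProg (SMP (wreathAlg SL SU T)) (oracles SL SU T) (TupleSym (Cell L U))) ⟨⟨none, none, 0, false⟩, (Tp.start (TupleList.enc ⟨k, b :: as⟩) :
        Tp (SMP (wreathAlg SL SU T)) (oracles SL SU T) (TupleSym (Cell L U))).fn⟩ 1
      ⟨⟨none, none, 0, false⟩, t₀.fn⟩ := by
    rw [ht₀, hft₀]
    split_ifs
    · exact (Reach.push _ _ _ _).cast le_rfl (by simp [Tp.start])
    · exact Reach.load _ _ _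
  have hword : TupleList.enc ⟨k, b :: as⟩ = List.replicate k .unit ++
      .sep :: ((List.ofFn fun j => TupleSym.el (b j)) ++ encTuples as) := rfl
  obtain ⟨ph, h1⟩ := reach_read_zero (P := SMP (wreathAlg SL SU T)) (O := O) (r := none)
    (s := none) (ok := false) (t := t₀) (c := diag c)
    (conv := fun a : TupleSym (L × U) => a.map pairCell) (List.replicate k .unit)
    (List.ofFn fun j => TupleSym.el (b j)) (encTuples as) .sep hword
    (fun a ha => by rw [List.eq_of_mem_replicate ha]; rfl) rfl
    (fun a ha => by
      obtain ⟨j, rfl⟩ := (List.mem_ofFn' _ _).1 ha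
      rfl)
    (fun a ha => by
      cases as with
      | nil => cases ha
      | cons a' as =>
        cases ha
        rfl)
  obtain ⟨rest, hrest⟩ := filterMap_entry_enc (diag c) (as.map fun a => pairCell ∘ a)
  have hbt : ((List.ofFn fun j => TupleSym.el (b j)).map
      fun a : TupleSym (L × U) => a.map pairCell).reverse = row (pairCell ∘ b) := by
    rw [List.map_ofFn]
    rfl
  set w : List (TupleSym (L × U)) := List.replicate k .unit ++ encTuples as with hw
  have hmap : w.map (TupleSym.map (pairCell : _ → Cell L U)) =
    TupleList.enc ⟨k, as.map fun a => pairCell ∘ a⟩ := map_enc _ _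
  set t₁ : Tp (SMP (wreathAlg SL SU T)) (oracles SL SU T) (TupleSym (Cell L U)) :=
    ({ t₀ with inp := [], bt := ((List.ofFn fun j => TupleSym.el (b j)).map
      fun a : TupleSym (L × U) => a.map pairCell).reverse ++ t₀.bt } : Tp _ _ _).read (diag c)
        (w.map (TupleSym.map pairCell)) with ht₁
  have hba : t₁.ba = row (lastTuple (diag c) (as.map fun a => pairCell ∘ a)) ++ rest := by
    rw [← hrest, ← hmap]
    exact List.append_nil _
  have hkt : t₁.kt = List.replicate k .unit := by
    refine (List.append_nil _).trans ?_
    rw [List.filter_reverse, hmap, filter_isUnit_enc, List.reverse_replicate]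
  have hft : t₁.ft = [] ↔ IsEmpty (F.Term (Fin as.length)) := by
    have : t₁.ft = (w.map (TupleSym.map pairCell)).reverse.filter TupleSym.isSep ++ ft₀ := rfl
    rw [this, List.append_eq_nil_iff, List.filter_reverse, List.reverse_eq_nil_iff, hmap,
      filter_isSep_enc, List.map_eq_nil_iff, hft₀]
    constructor
    · rintro ⟨rfl, h⟩
      by_contra hne
      have h0 : Nonempty (F.Term (Fin 0)) := not_isEmpty_iff.1 hne
      rw [if_pos h0] at h
      cases h
    · intro h
      have has : as = [] := by
        by_contra hne
        exact h.elim (Term.var ⟨0, List.length_pos_of_ne_nil hne⟩)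
      subst has
      exact ⟨rfl, if_neg (α := List (TupleSym (Cell L U))) (not_nonempty_iff.2 h : ¬ Nonempty (F.Term (Fin 0)))⟩
  obtain ⟨S, hSnd, hS, h2⟩ := reach_queryProg (P := SMP (wreathAlg SL SU T)) (O := O)
    (r := none) (ph := ph) (ok := false) hL hL0 hA hClo hO hc (k := k) (as := as) (t := t₁)
    (List.append_nil _) (List.append_nil _) hba rfl rfl rfl rfl
  obtain ⟨s, d, h3, hout, hd0, hd1⟩ := reach_sift (P := SMP (wreathAlg SL SU T)) (O := O)
    (r := none) (ph := ph) (ans := id)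
    (t := { t₁ with c1 := [], c2 := [], a1 := [], a0 := encTuples S })
    (fun p q x => termOp (wreathAlg SL SU T) m ![x, p, q]) S b _ rfl
    ((List.append_nil _).trans hbt) hba hkt rfl rfl rfl rfl rfl rfl rfl
  have hSlen := hS.length_le hSnd
  refine ⟨s, (config_start (P := SMP (wreathAlg SL SU T)) _ _).symm ▸
    (h0.seq (h1.seq (h2.seq h3))).mono ?_, d, ?_, hout⟩
  · change 1 + (9 * (TupleList.enc ⟨k, b :: as⟩).length + 2 + (6 * (TupleList.enc ⟨k, as⟩).length +
      2 * (k * Nat.card L ^ 2) * (13 * k + 9) + 10 + (4 * (S.length * (k + 1)) + 11 * k + 14 +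
          k * (S.length * (13 * k + 13 + S.length * (14 * k + 11)) + 6)))) ≤ _
    -- All parameters are replaced by the input length `n`, in which the bound is monotone.
    have hSn : S.length ≤ 2 * (n * Nat.card (L × U) ^ 2) := hSlen.trans (by gcongr)
    have e1 : 2 * (k * Nat.card L ^ 2) * (13 * k + 9) ≤
        2 * (n * Nat.card L ^ 2) * (13 * n + 9) := by gcongr
    have e2 : S.length * (k + 1) ≤ 2 * (n * Nat.card (L × U) ^ 2) * (n + 1) := by gcongr
    have e3 : k * (S.length * (13 * k + 13 + S.length * (14 * k + 11)) + 6) ≤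
        n * (2 * (n * Nat.card (L × U) ^ 2) * (13 * n + 13 +
          2 * (n * Nat.card (L × U) ^ 2) * (14 * n + 11)) + 6) := by gcongr
    rw [hn]
    omega
  · rcases isEmpty_or_nonempty (F.Term (Fin as.length)) with h | h
    · have hd := hd0 (hft.2 h)
      change d = true ↔ b ∈ Sg _ as
      rw [hd, Sg_eq_empty h]
      simp
    -- Sifting starts from the tuple on `ba`, an element of the `L × U`-subpower and hence of the
    -- `A`-subpower. The operation used is `m(x, p, q)`, so the Mal'tsev identities read `m(x, p, p)
    -- = x` and `m(x, x, q) = q`.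
    · obtain ⟨x, hx, hlast⟩ := hc.lastTuple h
      refine (hd1 (fun h' => (hft.1 h').elim h.some) x hlast).trans
        (mem_iff_siftPass (fun p x => (hm p x).1) (fun q x => (hm x q).2) ?_ ?_ ?_ ?_).symm
      · intro p hp q hq x hx
        have := termOp_mem_Sg (wreathAlg SL SU T) m (as := as) (x := ![x, p, q])
          (by simp [Fin.forall_fin_succ, hp, hq, hx])
        convert this using 3 with j
        funext i
        fin_cases i <;> rfl
      · exact fun p hp => hS.1 (List.mem_reverse.1 hp)
      · simp only [List.mem_reverse]
        exact hS.2.1.ge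
      · exact Sg_prodAlg_subset hClo (fun b hb => subset_Sg _ hb) hx

end Reductions

/-! ### The two reductions with their polynomial bounds -/

theorem mainTheorem4 {F : FirstOrder.Language.{v, w}} [F.IsAlgebraic]
    {R : Type*} [Ring R] {L U : Type} [AddCommGroup L] [Module R L] [Finite L] [Finite U]
    (SL : F.Structure L) (SU : F.Structure U)
    (T : ∀ n, F.Functions n → (Fin n → U) → L)
    (hL : IsAffine R SL)
    (hL0 : ∀ n (f : F.Functions n), SL.funMap f (fun _ => 0) = 0)
    (hA : IsMaltsev (wreathAlg SL SU T))
    (hClo : ∀ n, Clo (prodAlg SL SU) n ⊆ Clo (wreathAlg SL SU T) n) :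
    PolyTimeReduces (CompRep (wreathAlg SL SU T))
      ![CompRep (prodAlg SL SU), CompRepClonoid (Diff0 SL SU T)] ∧
    PolyTimeReduces (SMP (wreathAlg SL SU T))
      ![CompRep (prodAlg SL SU), CompRepClonoid (Diff0 SL SU T)] := by
  obtain ⟨c, hc⟩ := exists_isConstant (prodAlg SL SU)
  constructor
  · obtain ⟨p, hp⟩ : ∃ p : Polynomial ℕ, ∀ n, p.eval n =
        15 * n + 2 * (n * Nat.card L ^ 2) * (13 * n + 9) +
          6 * (2 * (n * Nat.card (L × U) ^ 2) * (n + 1)) + 16 :=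
      ⟨15 * .X + 2 * (.X * .C (Nat.card L ^ 2)) * (13 * .X + 9) +
        6 * (2 * (.X * .C (Nat.card (L × U) ^ 2)) * (.X + 1)) + 16, fun n => by simp⟩
    refine ⟨WT, TupleSym (Cell L U), Mem _, inferInstance, inferInstance, inferInstance,
      compRepProg SL SU T c, ⟨none, none, 2, false⟩, p, fun O hO x => ?_⟩
    obtain ⟨s, ⟨t, ht, hr⟩, hs⟩ := reach_compRepProg hL hL0 hA hClo hO hc x
    refine ⟨t, s, hr, ht.trans ?_, hs⟩
    -- The unary prefix of the encoding bounds `k` by the input length even when there are no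
    -- generators.
    have hk : x.k ≤ x.enc.length := (Nat.le_add_right _ _).trans (length_enc x.tuples).ge
    rw [hp]
    gcongr
  · obtain ⟨_, ⟨m, rfl⟩, hm⟩ := hA
    obtain ⟨p, hp⟩ : ∃ p : Polynomial ℕ, ∀ n, p.eval n =
        15 * n + 2 * (n * Nat.card L ^ 2) * (13 * n + 9) +
        4 * (2 * (n * Nat.card (L × U) ^ 2) * (n + 1)) + 11 * n + 27 +
          n * (2 * (n * Nat.card (L × U) ^ 2) * (13 * n + 13 +
            2 * (n * Nat.card (L × U) ^ 2) * (14 * n + 11)) + 6) :=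
      ⟨15 * .X + 2 * (.X * .C (Nat.card L ^ 2)) * (13 * .X + 9) +
        4 * (2 * (.X * .C (Nat.card (L × U) ^ 2)) * (.X + 1)) + 11 * .X + 27 +
          .X * (2 * (.X * .C (Nat.card (L × U) ^ 2)) * (13 * .X + 13 +
            2 * (.X * .C (Nat.card (L × U) ^ 2)) * (14 * .X + 11)) + 6), fun n => by simp⟩
    refine ⟨WT, TupleSym (Cell L U), Mem _, inferInstance, inferInstance, inferInstance,
      smpProg SL SU T c fun p q x => termOp (wreathAlg SL SU T) m ![x, p, q],
      ⟨none, none, 0, false⟩, p, fun O hO ⟨k, b, as⟩ => ?_⟩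
    obtain ⟨s, ⟨t, ht, hr⟩, hs⟩ := reach_smpProg hL hL0 ⟨_, ⟨m, rfl⟩, hm⟩ hClo hO hc hm b as rfl
    exact ⟨t, s, hr, ht.trans (hp _).ge, hs⟩
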